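/- **Theorem.** Let $m\ge 2$ be an integer, and let $U>0$, $\mu>0$ and $0<T<\infty$. For every arrival rate $\lambda>0$ the mode-suppression chain defined below is positive recurrent; that is, its stability region is $\{\lambda : \lambda>0\}$. *The model.* A file is divided into $m$ chunks. The type of a peer is the set $S\subsetneq[m]$ of chunks it has. A state is $x=(x_S)_{S\subsetneq[m]}\in\mathbb Z_{\ge0}^{2^m-1}$, where $x_S$ is the number of peers of type $S$. Put $|x|=\sum_S x_S$, $y_j=\sum_{S\ni j}x_S$, $\overline y=\max_j y_j$, $\underline y=\min_j y_j$. The set of suppressed chunks is $D_T(x)=\{j: y_j=\overline y\}$ if $\overline y-\underline y\ge T$, and $D_T(x)=\emptyset$ otherwise. The continuous-time Markov chain $X(t)$ has the following transitions. * A peer without chunks arrives, $x\to x+e_\emptyset$, at rate $\lambda$. * The seed, which has all the chunks, contacts a uniformly chosen peer at rate $U$, and each peer contacts a uniformly chosen peer at rate $\mu$. The contacting party transfers to the contacted peer one chunk, uniformly chosen among those that it has, that the contacted peer lacks, and that are not in $D_T(x)$ (none if there is no such chunk). A peer leaves as soon as it has all $m$ chunks. Thus, for $j\notin S\cup D_T(x)$,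 the transition in which a peer of type $S$ receives chunk $j$ (it becomes a peer of type $S\cup\{j\}$, or leaves if $S\cup\{j\}=[m]$) has rate $$\frac{x_S}{|x|}\Big(\frac{U}{|[m]\setminus(S\cup D_T(x))|}+\mu\sum_{R\ni j}\frac{x_R}{|R\setminus(S\cup D_T(x))|}\Big)$$ (read as $0$ if $x_S=0$), and for other $j$ it has rate $0$. *Positive recurrence* means the following. From every initial state the chain does not explode; the empty state $0$ can be reached from every state, so that the set $\mathcal C$ of states reachable from $0$ is the unique closed communicating class; and for every initial state $x$ and every $y\in\mathcal C$, $$\mathbb E_x[T_y]<\infty,\qquad T_y=\inf\{t\ge J_1: X(t)=y\},$$ where $J_1$ is the time of the first jump. In particular each state of $\mathcal C$ has finite mean return time. -/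

import Mathlib

open MeasureTheory ProbabilityTheory Finset
open scoped ENNReal NNReal

noncomputable section

/-! ### Continuous-time Markov chains on a countable state space -/

namespace CTMC

variable {E : Type*}

/-- Off-diagonal jump rates; the diagonal of `q` is irrelevant. -/
def offDiag (q : E → E → ℝ≥0∞) (x y : E) : ℝ≥0∞ :=
  open Classical in if y = x then 0 else q x y

/-- Total rate of leaving `x`. -/
def exitRate (q : E → E → ℝ≥0∞) (x : E) : ℝ≥0∞ := ∑' y, offDiag q x y

/-- Law of the state entered when the chain leaves `x`: `y` has probability
`q x y / exitRate q x`. (If the exit rate is zero or infinite, the state is repeated.) -/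
def jumpLaw [MeasurableSpace E] (q : E → E → ℝ≥0∞) (x : E) : Measure E :=
  open Classical in
  if h : tsum (offDiag q x) ≠ 0 ∧ tsum (offDiag q x) ≠ ∞ then
    (PMF.normalize (offDiag q x) h.1 h.2).toMeasure
  else Measure.dirac x

/-- Law of an exponential holding time of rate `r`; for `r = 0` the holding time is infinite, for
`r = ∞` it is zero. -/
def holdingLaw (r : ℝ≥0∞) : Measure ℝ≥0∞ :=
  if r = 0 then Measure.dirac ∞
  else if r = ∞ then Measure.dirac 0
  else (expMeasure r.toReal).map ENNReal.ofReal

instance [MeasurableSpace E] (q : E → E → ℝ≥0∞) (x : E) : IsProbabilityMeasure (jumpLaw q x) := by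
  unfold jumpLaw
  split_ifs <;> infer_instance

instance (r : ℝ≥0∞) : IsProbabilityMeasure (holdingLaw r) := by
  unfold holdingLaw
  split_ifs with h0 h1
  · infer_instance
  · infer_instance
  · have := isProbabilityMeasure_expMeasure (ENNReal.toReal_pos h0 h1)
    exact Measure.isProbabilityMeasure_map (by fun_prop)

/-- The states successively visited, each with the length of the corresponding visit. -/
abbrev Path (E : Type*) := ℕ → E × ℝ≥0∞

/-- The edges of the transition diagram. -/
def Step (q : E → E → ℝ≥0∞) (x y : E) : Prop := offDiag q x y ≠ 0

/-- `y` can be reached from `x` by finitely many (possibly zero) jumps of positive rate. -/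
def Reachable (q : E → E → ℝ≥0∞) : E → E → Prop := Relation.ReflTransGen (Step q)

section Law

variable [MeasurableSpace E] [Countable E] [MeasurableSingletonClass E]

/-- `E`-indexed kernel of jump laws. -/
def jumpKernel (q : E → E → ℝ≥0∞) : Kernel E E := Kernel.ofFunOfCountable (jumpLaw q)

/-- `E`-indexed kernel of holding time laws. -/
def holdKernel (q : E → E → ℝ≥0∞) : Kernel E ℝ≥0∞ :=
  Kernel.ofFunOfCountable fun x => holdingLaw (exitRate q x)

instance (q : E → E → ℝ≥0∞) : IsMarkovKernel (jumpKernel q) :=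
  ⟨fun x => inferInstanceAs (IsProbabilityMeasure (jumpLaw q x))⟩

instance (q : E → E → ℝ≥0∞) : IsMarkovKernel (holdKernel q) :=
  ⟨fun x => inferInstanceAs (IsProbabilityMeasure (holdingLaw (exitRate q x)))⟩

/-- From the current state: draw the next state by the jump law, and then its holding time. -/
def stepKernel (q : E → E → ℝ≥0∞) : Kernel E (E × ℝ≥0∞) :=
  jumpKernel q ⊗ₖ Kernel.prodMkLeft E (holdKernel q)

instance (q : E → E → ℝ≥0∞) : IsMarkovKernel (stepKernel q) := by
  unfold stepKernel; infer_instance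

/-- The step kernel, seen as a kernel from the past up to step `n`. -/
def histKernel (q : E → E → ℝ≥0∞) (n : ℕ) :
    Kernel (Π _ : Finset.Iic n, E × ℝ≥0∞) (E × ℝ≥0∞) :=
  (stepKernel q).comap (fun h => (h ⟨n, Finset.mem_Iic.2 le_rfl⟩).1) (by fun_prop)

instance (q : E → E → ℝ≥0∞) (n : ℕ) : IsMarkovKernel (histKernel q n) := by
  unfold histKernel; infer_instance

/-- Law of the jump chain with its holding times, started at `x`. -/
def pathLaw (q : E → E → ℝ≥0∞) (x : E) : Measure (Path E) :=
  Kernel.trajMeasure (X := fun _ => E × ℝ≥0∞)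
    ((Measure.dirac x).compProd (holdKernel q)) (histKernel q)

end Law

/-- Time of the `n`-th jump. -/
def jumpTime (n : ℕ) (ω : Path E) : ℝ≥0∞ := ∑ i ∈ range n, (ω i).2

/-- The continuous-time process `X(t)`; its value is `none` from the explosion time on. -/
def process (t : ℝ≥0) (ω : Path E) : Option E :=
  open Classical in
  if h : ∃ n, jumpTime n ω ≤ t ∧ t < jumpTime (n + 1) ω then some (ω (Nat.find h)).1 else none

/-- First time, not before the first jump, at which the process is in `y`
(`∞` if there is no such time). For a chain started at `y` it is the return time to `y`, for a
chain started elsewhere the hitting time of `y`. -/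
def passageTime (y : E) (ω : Path E) : ℝ≥0∞ :=
  ⨅ (t : ℝ≥0) (_ : jumpTime 1 ω ≤ t ∧ process t ω = some y), (t : ℝ≥0∞)

/-- Positive recurrence of a chain without absorbing states, started from an arbitrary state,
where the recurrent class is that of `x₀`: the chain does not explode, `x₀` can be reached from
every state (so the states reachable from `x₀` form a closed communicating class, and the only
one), the states of this class have finite mean return times, and they have finite mean hitting
times from every state. -/
structure IsPositiveRecurrent [MeasurableSpace E] [Countable E] [MeasurableSingletonClass E]
    (q : E → E → ℝ≥0∞) (x₀ : E) : Prop where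
  nonexplosive : ∀ x, ∀ᵐ ω ∂(pathLaw q x), ⨆ n, jumpTime n ω = ∞
  accessible : ∀ x, Reachable q x x₀
  mean_passage : ∀ x y, Reachable q x₀ y → ∫⁻ ω, passageTime y ω ∂(pathLaw q x) < ∞

end CTMC

/-! ### The mode-suppression chain of peer types -/

namespace ModeSuppression

/-- The type of a peer is the set of chunks it has: a proper subset of all `m` chunks. -/
abbrev PeerType (m : ℕ) := {S : Finset (Fin m) // S ≠ Finset.univ}

/-- `x S` is the number of peers of type `S`. -/
abbrev State (m : ℕ) := PeerType m → ℕ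

variable {m : ℕ}

/-- Number `|x|` of peers. -/
def peers (x : State m) : ℕ := ∑ S, x S

/-- Number `y_j` of peers that have chunk `j`. -/
def count (x : State m) (j : Fin m) : ℕ := ∑ S : PeerType m, if j ∈ S.1 then x S else 0

/-- Largest chunk count. -/
def maxCount (x : State m) : ℕ := ⨆ j, count x j

/-- Smallest chunk count. -/
def minCount (x : State m) : ℕ := ⨅ j, count x j

/-- The set of suppressed chunks: all the most frequent ones if the largest and the smallest count
differ by at least `T`, and none otherwise. -/
def suppressed (T : ℝ) (x : State m) : Finset (Fin m) :=
  open Classical in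
  Finset.univ.filter fun j => count x j = maxCount x ∧ (minCount x : ℝ) + T ≤ maxCount x

/-- Arrival of a peer without chunks. -/
def arrive (x : State m) : State m := fun S => x S + if S.1 = ∅ then 1 else 0

/-- A peer of type `S` receives chunk `j`; it leaves if this completes its set of chunks. -/
def transfer (x : State m) (S : PeerType m) (j : Fin m) : State m := fun R =>
  (if R = S then x R - 1 else x R) + if R.1 = insert j S.1 then 1 else 0

/-- Rate at which peers of type `S` receive chunk `j`. The seed at rate `U`, and every peer at rate
`μ`, contacts a uniformly chosen peer, and transfers to it a uniformly chosen one among the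
chunks which the sender has, the receiver lacks, and which are not suppressed. -/
def transferRate (U μ T : ℝ) (x : State m) (S : PeerType m) (j : Fin m) : ℝ :=
  if j ∈ S.1 ∪ suppressed T x then 0
  else (x S : ℝ) / peers x *
    (U / (Finset.univ \ (S.1 ∪ suppressed T x)).card +
      ∑ R : PeerType m,
        if j ∈ R.1 then μ * x R / (R.1 \ (S.1 ∪ suppressed T x)).card else 0)

/-- Transition rates of the chain. -/
def rate (lam U μ T : ℝ) (x x' : State m) : ℝ≥0∞ :=
  (if x' = arrive x then ENNReal.ofReal lam else 0) +
    ∑ S : PeerType m, ∑ j : Fin m,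
      if x' = transfer x S j then ENNReal.ofReal (transferRate U μ T x S j) else 0

/-- The arrival rates for which the chain is positive recurrent, the recurrent class being that of
the empty system. -/
def stabilityRegion (m : ℕ) (U μ T : ℝ) : Set ℝ :=
  {lam | 0 < lam ∧ CTMC.IsPositiveRecurrent (rate (m := m) lam U μ T) 0}

end ModeSuppression

end

/-!
The proof is by Foster's criterion, applied to an explicit Lyapunov function.

For a state `x` with counts `y_j`, let `Φ` be the total number of chunks which the peers lack. An
arrival raises `Φ` by `m` and every transfer lowers it by one. A rarest chunk is never suppressed,
and at least a fraction `1 / m` of the peers lacks it, so it is transferred at a rate of at least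
`(U + μ * min_j y_j) / m ^ 2` (`le_sum_transferRate`). Hence `Φ` has negative drift as soon as
`min_j y_j` is large. When it is not, two more terms are needed: the shortfall `∑ (M - y_j)⁺`
(`shortfall`), and the excess gap `∑ (max_i y_i - y_j - B)⁺` (`excessGap`).

* Apart from departures, transfers never raise the shortfall, and a transfer of a chunk with count
  below `M` lowers it. If all counts are bounded and the population is large, departures are rare,
  since almost all peers have no chunk.
* No transfer raises the excess gap (`excessGap_transfer`), and this is what mode suppression
  achieves: while chunks are suppressed, each transfer lowers the gap of the transferred chunk and
  leaves the other gaps unchanged; otherwise all gaps are less than `T`. If some count is large and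
  `min_j y_j` is not, every transfer of the rarest chunk lowers the excess gap, and the rate of the
  departures by other chunks is bounded, as these are departures of peers that have the rarest
  chunk.

With suitable coefficients the sum of the three terms (`lyapunov`) has drift at most `-1` outside
a finite set (`exists_lyapunov_drift_le`).

For general chains, Foster's criterion (`CTMC.lintegral_passageTime_lt_top`) and the criterion for
non-explosion (`CTMC.nonexplosive_of_drift`) are obtained by writing the expectations in question as
iterates of a one-step operator, with the Markov property of the path law
(`CTMC.lintegral_pathLaw_prod_succ`), and comparing these iterates with the Lyapunov function by
induction on the number of jumps.
-/

set_option linter.unusedSectionVars false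

open MeasureTheory ProbabilityTheory Finset
open scoped ENNReal NNReal

noncomputable section

namespace CTMC

/-! ### Exponential holding times -/

lemma measurable_gammaPDF (a r : ℝ) : Measurable (gammaPDF a r) :=
  (measurable_gammaPDFReal a r).ennreal_ofReal

lemma lintegral_holdingLaw {r : ℝ≥0∞} (h0 : r ≠ 0) (h1 : r ≠ ∞) {f : ℝ≥0∞ → ℝ≥0∞}
    (hf : Measurable f) :
    ∫⁻ t, f t ∂holdingLaw r =
      ∫⁻ t : ℝ, exponentialPDF r.toReal t * f (ENNReal.ofReal t) := by
  rw [holdingLaw, if_neg h0, if_neg h1, lintegral_map hf (by fun_prop), expMeasure, gammaMeasure,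
    lintegral_withDensity_eq_lintegral_mul _ (measurable_gammaPDF 1 r.toReal) (by fun_prop)]
  rfl

lemma holdingLaw_singleton_zero {r : ℝ≥0∞} (h0 : r ≠ 0) (h1 : r ≠ ∞) :
    holdingLaw r {0} = 0 := by
  rw [← lintegral_indicator_one (measurableSet_singleton 0),
    lintegral_holdingLaw h0 h1 (by fun_prop (disch := measurability))]
  refine (lintegral_congr_ae ?_).trans lintegral_zero
  filter_upwards [(measure_eq_zero_iff_ae_notMem (μ := volume) (s := {(0 : ℝ)})).1 (by simp)]
    with t ht
  rcases lt_or_gt_of_ne (show t ≠ 0 by simpa using ht) with h | h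
  · simp [exponentialPDF_of_neg h]
  · simp [h]

/-- The density of the holding time, weighted by `t`, is a multiple of the density of a Gamma law
of shape `2`. -/
lemma lintegral_holdingLaw_id {r : ℝ≥0∞} (h0 : r ≠ 0) (h1 : r ≠ ∞) :
    ∫⁻ t, t ∂holdingLaw r = r⁻¹ := by
  have hr := ENNReal.toReal_pos h0 h1
  rw [lintegral_holdingLaw h0 h1 (f := fun t => t) measurable_id]
  have key : ∀ t : ℝ, exponentialPDF r.toReal t * ENNReal.ofReal t =
      r⁻¹ * gammaPDF 2 r.toReal t := by
    intro t
    rcases lt_or_ge t 0 with h | h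
    · rw [exponentialPDF_of_neg h, gammaPDF_of_neg h]; simp
    · rw [exponentialPDF_of_nonneg h, gammaPDF_of_nonneg h, ← ENNReal.ofReal_mul (by positivity)]
      have hinv : r⁻¹ = ENNReal.ofReal r.toReal⁻¹ := by
        rw [ENNReal.ofReal_inv_of_pos hr, ENNReal.ofReal_toReal h1]
      rw [hinv, ← ENNReal.ofReal_mul (by positivity)]
      congr 1
      have : (2 : ℝ) - 1 = 1 := by norm_num
      rw [Real.Gamma_two, this, Real.rpow_one, Real.rpow_two]
      field_simp
  simp only [key]
  rw [lintegral_const_mul _ (measurable_gammaPDF 2 r.toReal),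
    lintegral_gammaPDF_eq_one (by norm_num) hr, mul_one]

/-- The discount factor `exp (-α t)`, equal to `0` for `t = ∞`. -/
def discount (α : ℝ) (t : ℝ≥0∞) : ℝ≥0∞ :=
  if t = ∞ then 0 else ENNReal.ofReal (Real.exp (-(α * t.toReal)))

@[fun_prop]
lemma measurable_discount (α : ℝ) : Measurable (discount α) := by
  unfold discount
  exact Measurable.ite (measurableSet_singleton _) (by fun_prop) (by fun_prop)

lemma discount_add (α : ℝ) (s t : ℝ≥0∞) : discount α (s + t) = discount α s * discount α t := by
  by_cases hs : s = ∞
  · simp [discount, hs]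
  by_cases ht : t = ∞
  · simp [discount, ht]
  rw [discount, discount, discount, if_neg (by simp [hs, ht]), if_neg hs, if_neg ht,
    ← ENNReal.ofReal_mul (by positivity), ← Real.exp_add, ENNReal.toReal_add hs ht]
  ring_nf

lemma prod_discount (α : ℝ) (f : ℕ → ℝ≥0∞) (n : ℕ) :
    ∏ i ∈ range n, discount α (f i) = discount α (∑ i ∈ range n, f i) := by
  induction n with
  | zero => simp [discount]
  | succ n ih => rw [prod_range_succ, sum_range_succ, ih, discount_add]

lemma discount_anti {α : ℝ} (hα : 0 ≤ α) {s t : ℝ≥0∞} (h : s ≤ t) :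
    discount α t ≤ discount α s := by
  by_cases ht : t = ∞
  · simp [discount, ht]
  have hs : s ≠ ∞ := ne_top_of_le_ne_top ht h
  rw [discount, discount, if_neg hs, if_neg ht]
  have := ENNReal.toReal_mono ht h
  gcongr

/-- The discounted density of the holding time of rate `r` is a multiple of the density for the
rate `r + α`. -/
lemma lintegral_holdingLaw_discount {r : ℝ≥0∞} (h0 : r ≠ 0) (h1 : r ≠ ∞) {α : ℝ} (hα : 0 ≤ α) :
    ∫⁻ t, discount α t ∂holdingLaw r = r / (r + ENNReal.ofReal α) := by
  have hr := ENNReal.toReal_pos h0 h1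
  rw [lintegral_holdingLaw h0 h1 (measurable_discount α)]
  have key : ∀ t : ℝ, exponentialPDF r.toReal t * discount α (ENNReal.ofReal t) =
      r / (r + ENNReal.ofReal α) * exponentialPDF (r.toReal + α) t := by
    intro t
    rcases lt_or_ge t 0 with h | h
    · rw [exponentialPDF_of_neg h, exponentialPDF_of_neg h]; simp
    · rw [exponentialPDF_of_nonneg h, exponentialPDF_of_nonneg h, discount, if_neg (by simp),
        ENNReal.toReal_ofReal h, ← ENNReal.ofReal_mul (by positivity)]
      conv_rhs => rw [← ENNReal.ofReal_toReal h1, ← ENNReal.ofReal_add hr.le hα,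
        ← ENNReal.ofReal_div_of_pos (by positivity), ← ENNReal.ofReal_mul (by positivity),
        ENNReal.toReal_ofReal hr.le]
      congr 1
      have hexp : Real.exp (-((r.toReal + α) * t)) =
          Real.exp (-(r.toReal * t)) * Real.exp (-(α * t)) := by
        rw [← Real.exp_add]; ring_nf
      rw [hexp]
      field_simp
  simp only [key]
  rw [lintegral_const_mul _ (f := exponentialPDF (r.toReal + α)) (measurable_gammaPDF 1 _),
    lintegral_exponentialPDF_eq_one (by positivity), mul_one]

/-! ### Integrals over the path law -/

section Law

variable {E : Type*} [MeasurableSpace E] [Countable E] [MeasurableSingletonClass E]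
  (q : E → E → ℝ≥0∞)

instance (x : E) : IsProbabilityMeasure (pathLaw q x) := by
  unfold pathLaw
  infer_instance

/-- Expectation of `f` at the next state of the jump chain. -/
def jumpMean (f : E → ℝ≥0∞) (x : E) : ℝ≥0∞ := ∫⁻ z, f z ∂jumpLaw q x

/-- Expectation of `b` at the current state and its holding time. -/
def holdMean (b : E × ℝ≥0∞ → ℝ≥0∞) (x : E) : ℝ≥0∞ := ∫⁻ t, b (x, t) ∂holdingLaw (exitRate q x)

lemma lintegral_stepKernel {b : E × ℝ≥0∞ → ℝ≥0∞} (hb : Measurable b) (x : E) :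
    ∫⁻ p, b p ∂stepKernel q x = jumpMean q (holdMean q b) x := by
  rw [stepKernel, Kernel.lintegral_compProd _ _ _ hb]
  rfl

lemma lintegral_pathLaw_zero {b : E × ℝ≥0∞ → ℝ≥0∞} (hb : Measurable b) (x : E) :
    ∫⁻ ω, b (ω 0) ∂pathLaw q x = holdMean q b x := by
  have h : (pathLaw q x).map (fun ω => ω 0) = (Measure.dirac x).compProd (holdKernel q) := by
    rw [pathLaw, Kernel.trajMeasure, Measure.map_comp _ _ (by fun_prop)]
    have h0 : Measurable fun h : (Π _ : Finset.Iic 0, E × ℝ≥0∞) => h ⟨0, by simp⟩ :=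
      measurable_pi_apply _
    have : (fun ω : Path E => ω 0) =
      (fun h : (Π _ : Finset.Iic 0, E × ℝ≥0∞) => h ⟨0, by simp⟩) ∘ Preorder.frestrictLe 0 := rfl
    rw [this, Kernel.map_comp_right _ (Preorder.measurable_frestrictLe 0) h0,
      Kernel.traj_map_frestrictLe, Kernel.partialTraj_self, Kernel.id_map,
      Measure.deterministic_comp_eq_map, Measure.map_map (by fun_prop) (by fun_prop)]
    · convert! Measure.map_id
    · exact h0
  rw [← lintegral_map (f := b) hb (measurable_pi_apply 0), h, Measure.lintegral_compProd hb,
    lintegral_dirac]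
  rfl

/-- Markov property: given the path up to step `n`, the next step has the law `stepKernel`. -/
lemma lintegral_pathLaw_prod_succ {g : ℕ → E × ℝ≥0∞ → ℝ≥0∞} (hg : ∀ i, Measurable (g i))
    {b : E × ℝ≥0∞ → ℝ≥0∞} (hb : Measurable b) (x : E) (n : ℕ) :
    ∫⁻ ω, (∏ i ∈ range (n + 1), g i (ω i)) * b (ω (n + 1)) ∂pathLaw q x =
      ∫⁻ ω, (∏ i ∈ range (n + 1), g i (ω i)) * jumpMean q (holdMean q b) (ω n).1
        ∂pathLaw q x := by
  have hG : Measurable fun h : (Π _ : Finset.Iic n, E × ℝ≥0∞) =>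
      ∏ i ∈ (range (n + 1)).attach,
        g i.1 (h ⟨i.1, Finset.mem_Iic.2 (Nat.lt_succ_iff.1 (mem_range.1 i.2))⟩) :=
    Finset.measurable_prod _ fun i _ => (hg _).comp (measurable_pi_apply _)
  have hP : ∀ ω : Path E, (∏ i ∈ range (n + 1), g i (ω i)) =
      ∏ i ∈ (range (n + 1)).attach, g i.1 (Preorder.frestrictLe (π := fun _ => E × ℝ≥0∞) n ω
        ⟨i.1, Finset.mem_Iic.2 (Nat.lt_succ_iff.1 (mem_range.1 i.2))⟩) := by
    intro ω
    rw [← Finset.prod_attach]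
    rfl
  have key := Kernel.map_frestrictLe_trajMeasure_compProd_eq_map_trajMeasure
    (X := fun _ => E × ℝ≥0∞) (μ₀ := (Measure.dirac x).compProd (holdKernel q))
    (κ := histKernel q) (a := n)
  have hm : Measurable fun p : (Π _ : Finset.Iic n, E × ℝ≥0∞) × (E × ℝ≥0∞) =>
      (∏ i ∈ (range (n + 1)).attach,
        g i.1 (p.1 ⟨i.1, Finset.mem_Iic.2 (Nat.lt_succ_iff.1 (mem_range.1 i.2))⟩)) * b p.2 :=
    (hG.comp measurable_fst).mul (hb.comp measurable_snd)
  have h2 := congrArg (fun ν => ∫⁻ p, (∏ i ∈ (range (n + 1)).attach,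
        g i.1 (p.1 ⟨i.1, Finset.mem_Iic.2 (Nat.lt_succ_iff.1 (mem_range.1 i.2))⟩)) * b p.2 ∂ν) key
  beta_reduce at h2
  rw [lintegral_map hm (by fun_prop), Measure.lintegral_compProd hm] at h2
  simp only [hP]
  refine h2.symm.trans ?_
  have hstep : ∀ h : (Π _ : Finset.Iic n, E × ℝ≥0∞),
      ∫⁻ p, b p ∂histKernel q n h =
        jumpMean q (holdMean q b) (h ⟨n, Finset.mem_Iic.2 le_rfl⟩).1 := by
    intro h
    rw [← lintegral_stepKernel q hb]
    rfl
  simp_rw [lintegral_const_mul _ hb, hstep]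
  rw [lintegral_map]
  · rfl
  · exact hG.mul ((measurable_of_countable (jumpMean q (holdMean q b))).comp
      (measurable_fst.comp (measurable_pi_apply _)))
  · fun_prop

/-- Given the path up to step `n - 1` and the state at step `n`, the holding time of that state
has its holding law. -/
lemma lintegral_pathLaw_prod {g : ℕ → E × ℝ≥0∞ → ℝ≥0∞} (hg : ∀ i, Measurable (g i))
    {b : E × ℝ≥0∞ → ℝ≥0∞} (hb : Measurable b) (x : E) (n : ℕ) :
    ∫⁻ ω, (∏ i ∈ range n, g i (ω i)) * b (ω n) ∂pathLaw q x =
      ∫⁻ ω, (∏ i ∈ range n, g i (ω i)) * holdMean q b (ω n).1 ∂pathLaw q x := by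
  have hmean : ∀ f : E → ℝ≥0∞, holdMean q (fun p => f p.1) = f := by
    intro f; ext z; simp [holdMean]
  have hm : Measurable fun p : E × ℝ≥0∞ => holdMean q b p.1 :=
    (measurable_of_countable (holdMean q b)).comp measurable_fst
  cases n with
  | zero =>
    simp only [range_zero, prod_empty, one_mul]
    rw [lintegral_pathLaw_zero q hb, lintegral_pathLaw_zero q hm, hmean]
  | succ n =>
    rw [lintegral_pathLaw_prod_succ q hg hb, lintegral_pathLaw_prod_succ q hg hm, hmean]

/-! ### One step of the jump chain -/

variable {q}

lemma jumpLaw_singleton {x : E} (h0 : exitRate q x ≠ 0) (h1 : exitRate q x ≠ ∞) (z : E) :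
    jumpLaw q x {z} = offDiag q x z * (exitRate q x)⁻¹ := by
  rw [jumpLaw, dif_pos ⟨h0, h1⟩, PMF.toMeasure_apply_singleton _ _ (measurableSet_singleton z),
    PMF.normalize_apply]
  rfl

lemma jumpMean_eq {x : E} (h0 : exitRate q x ≠ 0) (h1 : exitRate q x ≠ ∞) (f : E → ℝ≥0∞) :
    jumpMean q f x = (∑' z, offDiag q x z * f z) * (exitRate q x)⁻¹ := by
  rw [jumpMean, lintegral_countable', ← ENNReal.tsum_mul_right]
  refine tsum_congr fun z => ?_
  rw [jumpLaw_singleton h0 h1]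
  ring

variable (q)

lemma jumpMean_mono {f g : E → ℝ≥0∞} (h : ∀ z, f z ≤ g z) (x : E) :
    jumpMean q f x ≤ jumpMean q g x := lintegral_mono h

lemma jumpMean_add (f g : E → ℝ≥0∞) (x : E) :
    jumpMean q (fun z => f z + g z) x = jumpMean q f x + jumpMean q g x :=
  lintegral_add_left (measurable_of_countable f) g

lemma jumpMean_const (c : ℝ≥0∞) (x : E) : jumpMean q (fun _ => c) x = c := by
  simp [jumpMean]

lemma jumpMean_const_mul (c : ℝ≥0∞) (f : E → ℝ≥0∞) (x : E) :
    jumpMean q (fun z => c * f z) x = c * jumpMean q f x :=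
  lintegral_const_mul c (measurable_of_countable f)

lemma holdMean_fst (f : E → ℝ≥0∞) : holdMean q (fun p => f p.1) = f := by
  ext z
  simp [holdMean]

/-! ### A criterion for non-explosion -/

/-- Expectation of `f` at the next state, discounted by the holding time of the current state. -/
def discountedMean (α : ℝ) (f : E → ℝ≥0∞) (x : E) : ℝ≥0∞ :=
  exitRate q x / (exitRate q x + ENNReal.ofReal α) * jumpMean q f x

variable {q}

lemma lintegral_pathLaw_discount (h0 : ∀ x, exitRate q x ≠ 0) (h1 : ∀ x, exitRate q x ≠ ∞)
    {α : ℝ} (hα : 0 ≤ α) (f : E → ℝ≥0∞) (x : E) (n : ℕ) :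
    ∫⁻ ω, (∏ i ∈ range n, discount α (ω i).2) * f (ω n).1 ∂pathLaw q x =
      (discountedMean q α)^[n] f x := by
  have hd : ∀ i : ℕ, Measurable fun p : E × ℝ≥0∞ => discount α p.2 := fun _ => by fun_prop
  have hm : ∀ g : E → ℝ≥0∞, Measurable fun p : E × ℝ≥0∞ => g p.1 := fun g =>
    (measurable_of_countable g).comp measurable_fst
  induction n generalizing f with
  | zero =>
    simp only [range_zero, prod_empty, one_mul, Function.iterate_zero, id]
    rw [lintegral_pathLaw_zero q (hm f), holdMean_fst]
  | succ n ih =>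
    rw [Function.iterate_succ_apply, ← ih,
      lintegral_pathLaw_prod_succ q hd (hm f), holdMean_fst]
    simp only [prod_range_succ, mul_assoc]
    rw [lintegral_pathLaw_prod q hd (b := fun p => discount α p.2 * jumpMean q f p.1)
      ((hd 0).mul (hm _))]
    refine lintegral_congr fun ω => ?_
    congr 1
    dsimp only [holdMean]
    rw [lintegral_mul_const _ (measurable_discount α),
      lintegral_holdingLaw_discount (h0 _) (h1 _) hα, discountedMean]

/-- A chain does not explode if some function `W` with finite sublevel sets grows in the mean at
most exponentially. The discounted survival weight after `n` jumps is at most `ε W + θ ^ n`: the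
first term dominates where `W` is large, and on the finite set where it is not, each jump
discounts by at least some `θ < 1`. -/
theorem nonexplosive_of_drift (h0 : ∀ x, exitRate q x ≠ 0) (h1 : ∀ x, exitRate q x ≠ ∞)
    {α : ℝ} (hα : 0 < α) (W : E → ℝ≥0) (hfin : ∀ c : ℝ≥0, {x | W x ≤ c}.Finite)
    (hW : ∀ x, ∑' z, offDiag q x z * W z ≤ (exitRate q x + ENNReal.ofReal α) * W x) (x : E) :
    ∀ᵐ ω ∂pathLaw q x, ⨆ n, jumpTime n ω = ∞ := by
  set ρ : E → ℝ≥0∞ := fun x => exitRate q x / (exitRate q x + ENNReal.ofReal α) with hρ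
  have hα0 : ENNReal.ofReal α ≠ 0 := by simpa using hα
  have hρ1 : ∀ z, ρ z < 1 := fun z => by
    rw [hρ, ENNReal.div_lt_iff (by simp [h0]) (by simp [h1]), one_mul]
    exact ENNReal.lt_add_right (h1 z) hα0
  have hρW : ∀ z, discountedMean q α (fun z => W z) z ≤ W z := fun z => by
    rw [discountedMean, jumpMean_eq (h0 z) (h1 z), ENNReal.div_eq_inv_mul]
    calc (exitRate q z + ENNReal.ofReal α)⁻¹ * exitRate q z *
          ((∑' w, offDiag q z w * W w) * (exitRate q z)⁻¹)
        = (exitRate q z + ENNReal.ofReal α)⁻¹ * (∑' w, offDiag q z w * W w) *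
          (exitRate q z * (exitRate q z)⁻¹) := by ring
      _ ≤ (exitRate q z + ENNReal.ofReal α)⁻¹ * ((exitRate q z + ENNReal.ofReal α) * W z) *
          (exitRate q z * (exitRate q z)⁻¹) := by gcongr; exact hW z
      _ = W z := by
          rw [ENNReal.mul_inv_cancel (h0 z) (h1 z), mul_one, ← mul_assoc,
            ENNReal.inv_mul_cancel (by simp [h0]) (by simp [h1]), one_mul]
  have hle1 : ∀ n z, (discountedMean q α)^[n] (fun _ => 1) z ≤ 1 := by
    intro n
    induction n with
    | zero => intro z; simp
    | succ n ih =>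
      intro z
      rw [Function.iterate_succ_apply']
      calc discountedMean q α _ z ≤ 1 * jumpMean q (fun _ => 1) z := by
            unfold discountedMean
            gcongr
            · exact (hρ1 z).le
            · exact jumpMean_mono q ih z
        _ = 1 := by rw [jumpMean_const, one_mul]
  have hbound : ∀ ε : ℝ≥0, 0 < ε → ∃ θ < (1 : ℝ≥0∞), ∀ n z,
      (discountedMean q α)^[n] (fun _ => 1) z ≤ ε * W z + θ ^ n := by
    intro ε hε
    refine ⟨(hfin ε⁻¹).toFinset.sup ρ, (Finset.sup_lt_iff (by simp)).2 fun z _ => hρ1 z, ?_⟩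
    intro n
    induction n with
    | zero => intro z; simp
    | succ n ih =>
      intro z
      by_cases hz : W z ≤ ε⁻¹
      · rw [Function.iterate_succ_apply']
        calc discountedMean q α _ z
            ≤ ρ z * jumpMean q (fun w => ε * W w + (hfin ε⁻¹).toFinset.sup ρ ^ n) z := by
              unfold discountedMean
              gcongr
              exact jumpMean_mono q ih z
          _ = ε * discountedMean q α (fun w => W w) z +
                ρ z * (hfin ε⁻¹).toFinset.sup ρ ^ n := by
              rw [jumpMean_add, jumpMean_const, jumpMean_const_mul, discountedMean]
              ring
          _ ≤ ε * W z + (hfin ε⁻¹).toFinset.sup ρ ^ (n + 1) := by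
              rw [pow_succ']
              gcongr
              · exact hρW z
              · exact Finset.le_sup (f := ρ) (by simpa using hz)
      · refine (hle1 _ z).trans (le_add_right ?_)
        rw [not_le, inv_lt_iff_one_lt_mul₀ hε, mul_comm] at hz
        exact_mod_cast hz.le
  have hmeas : Measurable fun ω : Path E => ⨆ n, jumpTime n ω := by
    unfold jumpTime
    fun_prop
  have hzero : ∫⁻ ω, discount α (⨆ n, jumpTime n ω) ∂pathLaw q x = 0 := by
    have hlim : ∀ ε : ℝ≥0, 0 < ε →
        ∫⁻ ω, discount α (⨆ n, jumpTime n ω) ∂pathLaw q x ≤ ε * W x := by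
      intro ε hε
      obtain ⟨θ, hθ, hb⟩ := hbound ε hε
      have ht : Filter.Tendsto (fun n : ℕ => (ε : ℝ≥0∞) * W x + θ ^ n) Filter.atTop
          (nhds (ε * W x + 0)) :=
        (ENNReal.tendsto_pow_atTop_nhds_zero_of_lt_one hθ).const_add _
      rw [add_zero] at ht
      refine ge_of_tendsto' ht fun n => le_trans ?_ (hb n x)
      rw [← lintegral_pathLaw_discount h0 h1 hα.le]
      refine lintegral_mono fun ω => ?_
      rw [mul_one, prod_discount]
      exact discount_anti hα.le (le_iSup (fun n => jumpTime n ω) n)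
    refine le_antisymm (ENNReal.le_of_forall_pos_le_add fun δ hδ _ => ?_) (zero_le)
    rw [zero_add]
    refine (hlim (δ / (W x + 1)) (by positivity)).trans ?_
    rw [← ENNReal.coe_mul, ENNReal.coe_le_coe, div_mul_eq_mul_div, div_le_iff₀ (by positivity)]
    gcongr
    simp
  rw [lintegral_eq_zero_iff (by fun_prop)] at hzero
  filter_upwards [hzero] with ω hω
  by_contra hne
  rw [discount, if_neg hne] at hω
  simp only [Pi.zero_apply, ENNReal.ofReal_eq_zero] at hω
  exact absurd (Real.exp_pos _) (not_lt.2 hω)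

/-! ### A criterion for finite mean passage times -/

open Classical in
/-- `0` if the state `y` is entered at step `i ≥ 1`, and `1` otherwise. -/
def avoid (y : E) (i : ℕ) (p : E × ℝ≥0∞) : ℝ≥0∞ := if i ≠ 0 ∧ p.1 = y then 0 else 1

lemma measurable_avoid (y : E) (i : ℕ) : Measurable (avoid y i) :=
  (measurable_of_countable fun z : E => avoid y i (z, 0)).comp measurable_fst

variable (q) in
open Classical in
/-- Expectation of `f` at the next state, unless that state is `y`. -/
def tabooMean (y : E) (f : E → ℝ≥0∞) (x : E) : ℝ≥0∞ :=
  jumpMean q (fun z => if z = y then 0 else f z) x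

lemma lintegral_pathLaw_avoid (y : E) (f : E → ℝ≥0∞) (x : E) (n : ℕ) :
    ∫⁻ ω, (∏ i ∈ range (n + 1), avoid y i (ω i)) * f (ω n).1 ∂pathLaw q x =
      (tabooMean q y)^[n] f x := by
  have hm : ∀ g : E → ℝ≥0∞, Measurable fun p : E × ℝ≥0∞ => g p.1 := fun g =>
    (measurable_of_countable g).comp measurable_fst
  induction n generalizing f with
  | zero =>
    simp only [zero_add, range_one, prod_singleton, Function.iterate_zero, id, avoid, ne_eq,
      not_true_eq_false, false_and, if_false, one_mul]
    rw [lintegral_pathLaw_zero q (hm f), holdMean_fst]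
  | succ n ih =>
    rw [Function.iterate_succ_apply, ← ih]
    simp only [prod_range_succ _ (n + 1), mul_assoc]
    rw [lintegral_pathLaw_prod_succ q (measurable_avoid y)
      (b := fun p => avoid y (n + 1) p * f p.1) ((measurable_avoid y _).mul (hm f))]
    refine lintegral_congr fun ω => ?_
    congr 1
    rw [tabooMean]
    congr 1
    ext z
    by_cases hz : z = y <;> simp [holdMean, avoid, hz]

lemma lintegral_pathLaw_avoid_mul_hold (h0 : ∀ x, exitRate q x ≠ 0) (h1 : ∀ x, exitRate q x ≠ ∞)
    (y x : E) (n : ℕ) :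
    ∫⁻ ω, (∏ i ∈ range (n + 1), avoid y i (ω i)) * (ω n).2 ∂pathLaw q x =
      (tabooMean q y)^[n] (fun z => (exitRate q z)⁻¹) x := by
  rw [← lintegral_pathLaw_avoid]
  simp only [prod_range_succ, mul_assoc]
  rw [lintegral_pathLaw_prod q (measurable_avoid y) (b := fun p => avoid y n p * p.2)
    ((measurable_avoid y _).mul measurable_snd)]
  refine lintegral_congr fun ω => ?_
  congr 1
  have : ∀ t, avoid y n ((ω n).1, t) = avoid y n (ω n) := fun t => rfl
  simp only [holdMean, this]
  rw [lintegral_const_mul _ (f := fun t => t) measurable_id, lintegral_holdingLaw_id (h0 _) (h1 _)]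

lemma ae_hold_ne_zero (h0 : ∀ x, exitRate q x ≠ 0) (h1 : ∀ x, exitRate q x ≠ ∞) (x : E) :
    ∀ᵐ ω ∂pathLaw q x, ∀ n, (ω n).2 ≠ 0 := by
  rw [ae_all_iff]
  intro n
  have hb : Measurable fun p : E × ℝ≥0∞ => ({0} : Set ℝ≥0∞).indicator (fun _ => (1 : ℝ≥0∞)) p.2 :=
    (measurable_const.indicator (measurableSet_singleton 0)).comp measurable_snd
  have h := lintegral_pathLaw_prod q (g := fun _ _ => 1) (fun _ => measurable_const) hb x n
  have hz : ∀ z, holdMean q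
      (fun p : E × ℝ≥0∞ => ({0} : Set ℝ≥0∞).indicator (fun _ => (1 : ℝ≥0∞)) p.2) z = 0 := by
    intro z
    rw [holdMean, lintegral_indicator_const (measurableSet_singleton 0),
      holdingLaw_singleton_zero (h0 z) (h1 z), mul_zero]
  simp only [hz, mul_zero, lintegral_zero, prod_const_one, one_mul] at h
  rw [lintegral_eq_zero_iff
    (f := fun ω : Path E => ({0} : Set ℝ≥0∞).indicator (fun _ => 1) (ω n).2)
    (hb.comp (measurable_pi_apply n))] at h
  filter_upwards [h] with ω hω h0'
  simp [h0'] at hω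

/-- Along a path without explosion and without empty visits, the passage time to `y` is at most the
total holding time before the first step `≥ 1` at which `y` is entered. -/
lemma passageTime_le_tsum (y : E) (ω : Path E) (hpos : ∀ n, (ω n).2 ≠ 0)
    (hexp : ⨆ n, jumpTime n ω = ∞) :
    passageTime y ω ≤ ∑' n, (∏ i ∈ range (n + 1), avoid y i (ω i)) * (ω n).2 := by
  classical
  by_cases hy : ∃ n, n ≠ 0 ∧ (ω n).1 = y
  · set N := Nat.find hy with hN
    obtain ⟨hN0, hNy⟩ := Nat.find_spec hy
    have hterm : ∀ n ∈ range N, (∏ i ∈ range (n + 1), avoid y i (ω i)) * (ω n).2 = (ω n).2 := by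
      intro n hn
      rw [prod_eq_one, one_mul]
      intro i hi
      rw [avoid, if_neg]
      exact Nat.find_min hy (lt_of_le_of_lt (Nat.lt_succ_iff.1 (mem_range.1 hi)) (mem_range.1 hn))
    have hsum : jumpTime N ω ≤ ∑' n, (∏ i ∈ range (n + 1), avoid y i (ω i)) * (ω n).2 := by
      rw [jumpTime, ← sum_congr rfl hterm]
      exact ENNReal.sum_le_tsum _
    refine le_trans ?_ hsum
    by_cases hfin : jumpTime N ω = ∞
    · rw [hfin]; exact le_top
    have hmono : Monotone fun n => jumpTime n ω := fun a b hab =>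
      sum_le_sum_of_subset (range_mono hab)
    have hlt : jumpTime N ω < jumpTime (N + 1) ω := by
      have : jumpTime (N + 1) ω = jumpTime N ω + (ω N).2 := sum_range_succ _ _
      rw [this]
      exact ENNReal.lt_add_right hfin (hpos N)
    have hcoe : ((jumpTime N ω).toNNReal : ℝ≥0∞) = jumpTime N ω := ENNReal.coe_toNNReal hfin
    have hex : ∃ n, jumpTime n ω ≤ (jumpTime N ω).toNNReal ∧
        ((jumpTime N ω).toNNReal : ℝ≥0∞) < jumpTime (n + 1) ω :=
      ⟨N, by rw [hcoe]; exact ⟨le_rfl, hlt⟩⟩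
    have hfind : Nat.find hex = N := by
      rw [Nat.find_eq_iff]
      refine ⟨by rw [hcoe]; exact ⟨le_rfl, hlt⟩, fun k hk h => ?_⟩
      rw [hcoe] at h
      exact absurd h.2 (not_lt.2 (hmono (Nat.succ_le_of_lt hk)))
    refine (iInf₂_le (jumpTime N ω).toNNReal ⟨?_, ?_⟩).trans hcoe.le
    · rw [hcoe]
      exact hmono (Nat.one_le_iff_ne_zero.2 hN0)
    · rw [process, dif_pos hex]
      congr 1
      convert hNy
  · push Not at hy
    have hterm : ∀ n, (∏ i ∈ range (n + 1), avoid y i (ω i)) * (ω n).2 = (ω n).2 := by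
      intro n
      rw [prod_eq_one, one_mul]
      intro i _
      rw [avoid, if_neg]
      rintro ⟨hi, h⟩
      exact hy i hi h
    simp only [hterm]
    rw [ENNReal.tsum_eq_iSup_nat]
    exact le_top.trans hexp.ge

variable (q) in
/-- Mean of the total holding time before the first step `≥ 1` at which `y` is entered, counting
only the first `n` holding times. -/
def truncatedPassage (y : E) : ℕ → E → ℝ≥0∞
  | 0 => fun _ => 0
  | n + 1 => fun x => (exitRate q x)⁻¹ + tabooMean q y (truncatedPassage y n) x

lemma sum_iterate_tabooMean (y x : E) (n : ℕ) :
    ∑ i ∈ range n, (tabooMean q y)^[i] (fun z => (exitRate q z)⁻¹) x =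
      truncatedPassage q y n x := by
  induction n generalizing x with
  | zero => simp [truncatedPassage]
  | succ n ih =>
    rw [sum_range_succ', add_comm, truncatedPassage]
    simp only [Function.iterate_zero, id, Function.iterate_succ_apply']
    congr 1
    simp only [tabooMean, jumpMean]
    rw [← lintegral_finsetSum _ fun i _ => measurable_of_countable _]
    refine lintegral_congr fun z => ?_
    split_ifs with hz
    · simp
    · rw [← ih]

lemma tabooMean_mono (y : E) {f g : E → ℝ≥0∞} (h : ∀ z, f z ≤ g z) (x : E) :
    tabooMean q y f x ≤ tabooMean q y g x := by
  refine jumpMean_mono q (fun z => ?_) x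
  split_ifs
  · exact le_rfl
  · exact h z

lemma truncatedPassage_le_succ (y : E) (n : ℕ) (x : E) :
    truncatedPassage q y n x ≤ truncatedPassage q y (n + 1) x := by
  induction n generalizing x with
  | zero => simp [truncatedPassage]
  | succ n ih =>
    exact add_le_add le_rfl (tabooMean_mono y ih x)

lemma tabooMean_le (y : E) (f : E → ℝ≥0∞) (x : E) : tabooMean q y f x ≤ jumpMean q f x := by
  refine jumpMean_mono q (fun z => ?_) x
  split_ifs
  · exact zero_le
  · exact le_rfl

lemma truncatedPassage_ne_top {c : ℝ≥0∞} (hc0 : c ≠ 0)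
    (hc : ∀ x, c ≤ exitRate q x) (y : E) (n : ℕ) (x : E) : truncatedPassage q y n x ≠ ∞ := by
  have key : ∀ x, truncatedPassage q y n x ≤ n * c⁻¹ := by
    induction n with
    | zero => simp [truncatedPassage]
    | succ n ih =>
      intro x
      calc truncatedPassage q y (n + 1) x
          = (exitRate q x)⁻¹ + tabooMean q y (truncatedPassage q y n) x := rfl
        _ ≤ c⁻¹ + jumpMean q (fun _ => n * c⁻¹) x :=
            add_le_add (ENNReal.inv_le_inv.2 (hc x))
              ((tabooMean_le y _ x).trans (jumpMean_mono q ih x))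
        _ = (n + 1 : ℕ) * c⁻¹ := by rw [jumpMean_const, Nat.cast_succ]; ring
  exact ne_top_of_le_ne_top (ENNReal.mul_ne_top (by simp) (by simpa using hc0)) (key x)

/-- Foster's criterion: if `V` decreases in the mean at rate at least one outside a finite set `F`,
and `y` can be reached from everywhere, then the mean passage times to `y` are finite.

With `A n` the maximum over `F` of the truncated mean passage times, the drift condition bounds
the truncated mean passage time from `x` by `V x + A n`; following a path from `x` to `y` improves
this to `C + (1 - ε) A n` for `x ∈ F`. Hence `A n ≤ C / ε` for all `n`. -/
theorem lintegral_passageTime_lt_top (h0 : ∀ x, exitRate q x ≠ 0) (h1 : ∀ x, exitRate q x ≠ ∞)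
    {c : ℝ≥0∞} (hc0 : c ≠ 0) (hc : ∀ x, c ≤ exitRate q x)
    (hne : ∀ x, ∀ᵐ ω ∂pathLaw q x, ⨆ n, jumpTime n ω = ∞)
    (V : E → ℝ≥0) (F : Finset E)
    (hV : ∀ x, ∑' z, offDiag q x z * V z ≠ ∞)
    (hF : ∀ x, x ∉ F → ∑' z, offDiag q x z * V z + 1 ≤ exitRate q x * V x)
    (y : E) (hy : ∀ x, Reachable q x y) (x : E) :
    ∫⁻ ω, passageTime y ω ∂pathLaw q x < ∞ := by
  classical
  set h := truncatedPassage q y with hh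
  set A : ℕ → ℝ≥0∞ := fun n => F.sup (h n) with hA
  have hAfin : ∀ n, A n ≠ ∞ := fun n => by
    rw [← lt_top_iff_ne_top, hA, Finset.sup_lt_iff (by simp)]
    exact fun z _ => (truncatedPassage_ne_top hc0 hc y n z).lt_top
  have hbound : ∀ n x, h n x ≤ V x + A n := by
    intro n
    induction n with
    | zero => intro x; simp [hh, truncatedPassage]
    | succ n ih =>
      intro x
      by_cases hx : x ∈ F
      · exact le_add_left (Finset.le_sup (f := h (n + 1)) hx)
      · have hAm : A n ≤ A (n + 1) :=
          Finset.sup_mono_fun fun z _ => truncatedPassage_le_succ y n z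
        calc h (n + 1) x = (exitRate q x)⁻¹ + tabooMean q y (h n) x := rfl
          _ ≤ (exitRate q x)⁻¹ + jumpMean q (fun z => V z + A n) x := by
            gcongr
            exact (tabooMean_le y _ x).trans (jumpMean_mono q ih x)
          _ = (∑' z, offDiag q x z * V z + 1) * (exitRate q x)⁻¹ + A n := by
            rw [jumpMean_add, jumpMean_const, jumpMean_eq (h0 x) (h1 x)]
            ring
          _ ≤ (exitRate q x * V x) * (exitRate q x)⁻¹ + A (n + 1) := by
            gcongr
            exact hF x hx
          _ = V x + A (n + 1) := by
            rw [mul_right_comm, ENNReal.mul_inv_cancel (h0 x) (h1 x), one_mul]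
  -- A state with a jump to a good state `z` is good, even if it is `y` itself.
  have hstep : ∀ x z, Step q x z →
      (∃ C ε : ℝ≥0∞, C ≠ ∞ ∧ ε ≠ 0 ∧ ∀ n, (if z = y then 0 else h n z) + ε * A n ≤ C + A n) →
      ∃ C ε : ℝ≥0∞, C ≠ ∞ ∧ ε ≠ 0 ∧ ∀ n, h n x + ε * A n ≤ C + A n := by
    rintro x z hxz ⟨C, ε, hC, hε, hz⟩
    refine ⟨(exitRate q x)⁻¹ + jumpMean q (fun w => V w) x + C, jumpLaw q x {z} * ε, ?_, ?_, ?_⟩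
    · rw [jumpMean_eq (h0 x) (h1 x)]
      have := ENNReal.inv_ne_top.2 (h0 x)
      exact ENNReal.add_ne_top.2
        ⟨ENNReal.add_ne_top.2 ⟨this, ENNReal.mul_ne_top (hV x) this⟩, hC⟩
    · rw [jumpLaw_singleton (h0 x) (h1 x)]
      exact mul_ne_zero (mul_ne_zero hxz (ENNReal.inv_ne_zero.2 (h1 x))) hε
    · intro n
      have hsing : jumpMean q (fun w => ({z} : Set E).indicator (fun _ => ε * A n) w) x =
          jumpLaw q x {z} * ε * A n := by
        rw [jumpMean, lintegral_indicator_const (measurableSet_singleton z)]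
        ring
      calc h n x + jumpLaw q x {z} * ε * A n
          ≤ h (n + 1) x + jumpLaw q x {z} * ε * A n := by
            gcongr
            exact truncatedPassage_le_succ y n x
        _ = (exitRate q x)⁻¹ + jumpMean q (fun w => (if w = y then 0 else h n w) +
              ({z} : Set E).indicator (fun _ => ε * A n) w) x := by
            rw [jumpMean_add, hsing, ← add_assoc]
            rfl
        _ ≤ (exitRate q x)⁻¹ + jumpMean q (fun w => V w + (C + A n)) x := by
            gcongr
            refine jumpMean_mono q (fun w => ?_) x
            by_cases hw : w = z
            · subst hw
              simp only [Set.indicator_of_mem (Set.mem_singleton _)]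
              exact (hz n).trans le_add_self
            · rw [Set.indicator_of_notMem (by simpa using hw), add_zero]
              split_ifs
              · exact zero_le
              · refine (hbound n w).trans ?_
                gcongr
                exact le_add_self
        _ = _ := by
            rw [jumpMean_add, jumpMean_const]
            ring
  have hgood : ∀ x, ∃ C ε : ℝ≥0∞, C ≠ ∞ ∧ ε ≠ 0 ∧
      ∀ n, (if x = y then 0 else h n x) + ε * A n ≤ C + A n := by
    intro x
    induction hy x using Relation.ReflTransGen.head_induction_on with
    | refl => exact ⟨0, 1, by simp, by simp, fun n => by simp⟩
    | head hxz _ ih =>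
      obtain ⟨C, ε, hC, hε, hn⟩ := hstep _ _ hxz ih
      refine ⟨C, ε, hC, hε, fun n => le_trans ?_ (hn n)⟩
      gcongr
      split_ifs
      · exact zero_le
      · exact le_rfl
  have hall : ∀ x, ∃ C ε : ℝ≥0∞, C ≠ ∞ ∧ ε ≠ 0 ∧ ∀ n, h n x + ε * A n ≤ C + A n := by
    intro x
    have hx := h0 x
    rw [exitRate, ne_eq, ENNReal.tsum_eq_zero] at hx
    push Not at hx
    obtain ⟨z, hz⟩ := hx
    exact hstep x z hz (hgood z)
  choose C ε hC hε hn using hall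
  have hAbound : ∃ B : ℝ≥0∞, B ≠ ∞ ∧ ∀ n, A n ≤ B := by
    refine ⟨∑ z ∈ F, C z / ε z, ?_, fun n => ?_⟩
    · exact ENNReal.sum_ne_top.2 fun z _ => ENNReal.div_ne_top (hC z) (hε z)
    · rcases F.eq_empty_or_nonempty with hemp | hnon
      · simp [hA, hemp]
      · obtain ⟨z, hz, hzA⟩ := Finset.exists_mem_eq_sup F hnon (h n)
        have h2 := hn z n
        have h3 : ε z * A n ≤ C z := by
          have : h n z = A n := hzA.symm
          rw [this, add_comm] at h2
          exact (ENNReal.add_le_add_iff_right (hAfin n)).1 h2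
        calc A n ≤ C z / ε z := by
              have hεt : ε z = ∞ → A n = 0 := by
                intro ht
                by_contra hA0
                rw [ht, ENNReal.top_mul hA0, top_le_iff] at h3
                exact hC z h3
              by_cases ht : ε z = ∞
              · rw [hεt ht]; exact zero_le
              · rw [ENNReal.le_div_iff_mul_le (Or.inl (hε z)) (Or.inl ht), mul_comm]
                exact h3
          _ ≤ _ := Finset.single_le_sum (f := fun z => C z / ε z) (fun _ _ => zero_le) hz
  obtain ⟨B, hB, hAB⟩ := hAbound
  have hint : ∫⁻ ω, passageTime y ω ∂pathLaw q x ≤ V x + B := by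
    calc ∫⁻ ω, passageTime y ω ∂pathLaw q x
        ≤ ∫⁻ ω, ∑' n, (∏ i ∈ range (n + 1), avoid y i (ω i)) * (ω n).2 ∂pathLaw q x := by
          refine lintegral_mono_ae ?_
          filter_upwards [hne x, ae_hold_ne_zero h0 h1 x] with ω hω hω'
          exact passageTime_le_tsum y ω hω' hω
      _ = ∑' n, (tabooMean q y)^[n] (fun z => (exitRate q z)⁻¹) x := by
          rw [lintegral_tsum]
          · simp only [lintegral_pathLaw_avoid_mul_hold h0 h1]
          · intro n
            refine (Measurable.mul ?_ (measurable_snd.comp (measurable_pi_apply n))).aemeasurable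
            exact Finset.measurable_prod _ fun i _ =>
              (measurable_avoid y i).comp (measurable_pi_apply i)
      _ ≤ V x + B := by
          refine ENNReal.tsum_le_of_sum_range_le fun n => ?_
          rw [sum_iterate_tabooMean]
          exact (hbound n x).trans (by gcongr; exact hAB n)
  exact hint.trans_lt (ENNReal.add_lt_top.2 ⟨ENNReal.coe_lt_top, hB.lt_top⟩)

end Law

end CTMC

namespace ModeSuppression

variable {m : ℕ}

/-! ### Effect of the transitions on linear functionals -/

/-- Peers of type `S` can receive chunk `j`. -/
def Enabled (T : ℝ) (x : State m) (S : PeerType m) (j : Fin m) : Prop :=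
  x S ≠ 0 ∧ j ∉ S.1 ∧ j ∉ suppressed T x

/-- Number of chunks which the peers lack in total. -/
def missing (x : State m) : ℕ := ∑ S : PeerType m, (m - S.1.card) * x S

lemma transferRate_eq_zero {U μ T : ℝ} {x : State m} {S : PeerType m} {j : Fin m}
    (h : ¬ Enabled T x S j) : transferRate U μ T x S j = 0 := by
  rw [transferRate]
  split_ifs with hj
  · rfl
  · rw [mem_union, not_or] at hj
    have : x S = 0 := by
      by_contra hx
      exact h ⟨hx, hj.1, hj.2⟩
    simp [this]

lemma transferRate_nonneg {U μ : ℝ} (hU : 0 ≤ U) (hμ : 0 ≤ μ) (T : ℝ) (x : State m)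
    (S : PeerType m) (j : Fin m) : 0 ≤ transferRate U μ T x S j := by
  rw [transferRate]
  split_ifs
  · exact le_rfl
  · have : 0 ≤ ∑ R : PeerType m,
        if j ∈ R.1 then μ * x R / ((R.1 \ (S.1 ∪ suppressed T x)).card : ℝ) else 0 :=
      sum_nonneg fun R _ => by split_ifs <;> positivity
    positivity

lemma sum_mul_arrive (hm : 0 < m) (w : Finset (Fin m) → ℕ) (x : State m) :
    ∑ R : PeerType m, w R.1 * arrive x R = ∑ R : PeerType m, w R.1 * x R + w ∅ := by
  have hne : (∅ : Finset (Fin m)) ≠ univ := by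
    have : Nonempty (Fin m) := ⟨⟨0, hm⟩⟩
    exact (univ_nonempty.ne_empty).symm
  simp only [arrive, mul_add, sum_add_distrib]
  congr 1
  rw [sum_eq_single_of_mem (⟨∅, hne⟩ : PeerType m) (mem_univ _)]
  · simp
  · intro R _ hR
    rw [if_neg (fun h => hR (Subtype.ext h)), mul_zero]

lemma sum_mul_transfer (w : Finset (Fin m) → ℕ) {x : State m} {S : PeerType m} (hS : x S ≠ 0)
    (j : Fin m) :
    ∑ R : PeerType m, w R.1 * transfer x S j R + w S.1 =
      ∑ R : PeerType m, w R.1 * x R + if insert j S.1 = univ then 0 else w (insert j S.1) := by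
  have h1 : ∑ R : PeerType m, w R.1 * (if R = S then x R - 1 else x R) + w S.1 =
      ∑ R : PeerType m, w R.1 * x R := by
    rw [← add_sum_erase _ _ (mem_univ S), ← add_sum_erase _ _ (mem_univ S)]
    rw [if_pos rfl]
    have h2 : ∑ R ∈ univ.erase S, w R.1 * (if R = S then x R - 1 else x R) =
        ∑ R ∈ univ.erase S, w R.1 * x R :=
      sum_congr rfl fun R hR => by rw [if_neg (ne_of_mem_erase hR)]
    rw [h2]
    obtain ⟨k, hk⟩ := Nat.exists_eq_succ_of_ne_zero hS
    rw [hk, Nat.succ_sub_one, Nat.mul_succ]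
    ring
  have h2 : ∑ R : PeerType m, w R.1 * (if R.1 = insert j S.1 then 1 else 0) =
      if insert j S.1 = univ then 0 else w (insert j S.1) := by
    split_ifs with h
    · refine sum_eq_zero fun R _ => ?_
      rw [if_neg (fun hR => R.2 (hR.trans h)), mul_zero]
    · rw [sum_eq_single_of_mem (⟨insert j S.1, h⟩ : PeerType m) (mem_univ _)]
      · simp
      · intro R _ hR
        rw [if_neg (fun hR' => hR (Subtype.ext hR')), mul_zero]
  simp only [transfer, mul_add, sum_add_distrib]
  rw [h2, ← h1]
  ring

lemma count_eq_sum_mul (x : State m) (i : Fin m) :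
    count x i = ∑ R : PeerType m, (if i ∈ R.1 then 1 else 0) * x R := by
  simp [count]

lemma peers_eq_sum_mul (x : State m) : peers x = ∑ R : PeerType m, 1 * x R := by
  simp [peers]

lemma peers_arrive (hm : 0 < m) (x : State m) : peers (arrive x) = peers x + 1 := by
  rw [peers_eq_sum_mul, peers_eq_sum_mul, sum_mul_arrive hm fun _ => 1]

lemma count_arrive (hm : 0 < m) (x : State m) (i : Fin m) : count (arrive x) i = count x i := by
  rw [count_eq_sum_mul, count_eq_sum_mul, sum_mul_arrive hm fun R => if i ∈ R then 1 else 0]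
  simp

lemma missing_arrive (hm : 0 < m) (x : State m) : missing (arrive x) = missing x + m := by
  rw [missing, missing, sum_mul_arrive hm fun R => m - R.card]
  simp

lemma peers_transfer_le {x : State m} {S : PeerType m} (hS : x S ≠ 0) (j : Fin m) :
    peers (transfer x S j) ≤ peers x := by
  have h := sum_mul_transfer (fun _ => 1) hS j
  rw [← peers_eq_sum_mul, ← peers_eq_sum_mul] at h
  split_ifs at h <;> omega

lemma missing_transfer {x : State m} {S : PeerType m} (hS : x S ≠ 0) {j : Fin m} (hj : j ∉ S.1) :
    missing (transfer x S j) + 1 = missing x := by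
  have h := sum_mul_transfer (fun R => m - R.card) hS j
  have hc : (insert j S.1).card = S.1.card + 1 := card_insert_of_notMem hj
  have hle : (insert j S.1).card ≤ m := by simpa using card_le_univ (insert j S.1)
  change missing (transfer x S j) + (m - S.1.card) = missing x + _ at h
  split_ifs at h with hu
  · rw [hu, card_univ, Fintype.card_fin] at hc
    omega
  · omega

lemma count_transfer {x : State m} {S : PeerType m} (hS : x S ≠ 0) {j : Fin m} (hj : j ∉ S.1)
    (hu : insert j S.1 ≠ univ) (i : Fin m) :
    count (transfer x S j) i = count x i + if i = j then 1 else 0 := by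
  have h := sum_mul_transfer (fun R => if i ∈ R then 1 else 0) hS j
  rw [← count_eq_sum_mul, ← count_eq_sum_mul, if_neg hu] at h
  by_cases hi : i = j
  · subst hi
    simpa [hj] using h
  · simpa [hi] using h

lemma mem_of_insert_eq_univ {S : Finset (Fin m)} {i j : Fin m} (hu : insert j S = univ)
    (hi : i ≠ j) : i ∈ S :=
  mem_of_mem_insert_of_ne (hu ▸ mem_univ i) hi

/-- If a peer leaves after receiving chunk `j`, then the other counts drop by one. -/
lemma count_transfer_of_eq_univ {x : State m} {S : PeerType m} (hS : x S ≠ 0) {j : Fin m}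
    (hj : j ∉ S.1) (hu : insert j S.1 = univ) (i : Fin m) :
    count (transfer x S j) i + (if i = j then 0 else 1) = count x i := by
  have h := sum_mul_transfer (fun R => if i ∈ R then 1 else 0) hS j
  rw [← count_eq_sum_mul, ← count_eq_sum_mul, if_pos hu] at h
  by_cases hi : i = j
  · subst hi
    simpa [hj] using h
  · simpa [hi, mem_of_insert_eq_univ hu hi] using h

lemma le_count (x : State m) {S : PeerType m} {i : Fin m} (hi : i ∈ S.1) : x S ≤ count x i := by
  have := single_le_sum (f := fun S : PeerType m => if i ∈ S.1 then x S else 0)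
    (fun _ _ => Nat.zero_le _) (mem_univ S)
  simpa [hi, count] using this

lemma count_le_peers (x : State m) (i : Fin m) : count x i ≤ peers x :=
  sum_le_sum fun S _ => by split_ifs <;> simp

lemma count_le_maxCount (x : State m) (i : Fin m) : count x i ≤ maxCount x :=
  le_ciSup (Set.finite_range _).bddAbove i

lemma minCount_le_count (x : State m) (i : Fin m) : minCount x ≤ count x i :=
  ciInf_le (Set.finite_range _).bddBelow i

lemma exists_count_eq_minCount (hm : 0 < m) (x : State m) : ∃ j, count x j = minCount x :=
  have : Nonempty (Fin m) := ⟨⟨0, hm⟩⟩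
  exists_eq_ciInf_of_finite

lemma maxCount_le (hm : 0 < m) {x : State m} {c : ℕ} (h : ∀ i, count x i ≤ c) : maxCount x ≤ c :=
  have : Nonempty (Fin m) := ⟨⟨0, hm⟩⟩
  ciSup_le h

lemma mem_suppressed {T : ℝ} {x : State m} {j : Fin m} :
    j ∈ suppressed T x ↔ count x j = maxCount x ∧ (minCount x : ℝ) + T ≤ maxCount x := by
  simp [suppressed]

/-- A rarest chunk is never suppressed. -/
lemma notMem_suppressed {T : ℝ} (hT : 0 < T) {x : State m} {j : Fin m}
    (hj : count x j = minCount x) : j ∉ suppressed T x := by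
  rw [mem_suppressed, ← hj]
  rintro ⟨h1, h2⟩
  rw [← h1] at h2
  linarith

/-! ### Bounds on the transfer rates -/

lemma transferRate_le {U μ T : ℝ} (hU : 0 ≤ U) (hμ : 0 ≤ μ) {x : State m} {S : PeerType m}
    {j : Fin m} (h : Enabled T x S j) :
    transferRate U μ T x S j ≤ (x S : ℝ) / peers x * (U + μ * count x j) := by
  obtain ⟨_, hj, hD⟩ := h
  have hjn : j ∉ S.1 ∪ suppressed T x := by simp [hj, hD]
  rw [transferRate, if_neg hjn]
  gcongr
  · exact div_le_self hU (by
      exact_mod_cast card_pos.2 ⟨j, mem_sdiff.2 ⟨mem_univ j, hjn⟩⟩)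
  · rw [count, Nat.cast_sum, mul_sum]
    refine sum_le_sum fun R _ => ?_
    split_ifs with hR
    · exact div_le_self (by positivity) (by
        exact_mod_cast card_pos.2 ⟨j, mem_sdiff.2 ⟨hR, hjn⟩⟩)
    · simp

lemma sum_count_le (hm : 0 < m) (x : State m) : ∑ j, count x j ≤ (m - 1) * peers x := by
  simp only [count]
  rw [sum_comm, peers, mul_sum]
  refine sum_le_sum fun S _ => ?_
  rw [sum_ite_mem, sum_const, univ_inter, smul_eq_mul]
  gcongr
  have : S.1.card < Fintype.card (Fin m) := card_lt_univ_of_notMem (x := ?_) ?_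
  · rw [Fintype.card_fin] at this
    omega
  · exact (not_forall.1 (fun h => S.2 (eq_univ_iff_forall.2 h))).choose
  · exact (not_forall.1 (fun h => S.2 (eq_univ_iff_forall.2 h))).choose_spec

/-- Every peer lacks a chunk, so at least a fraction `1 / m` of the peers lacks a rarest chunk.
Since that chunk is not suppressed, it is transferred at a rate that does not depend on the number of
peers. -/
lemma le_sum_transferRate (hm : 0 < m) {U μ T : ℝ} (hU : 0 ≤ U) (hμ : 0 ≤ μ) (hT : 0 < T)
    {x : State m} (hx : peers x ≠ 0) {j : Fin m} (hj : count x j = minCount x) :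
    (U + μ * minCount x) / m ^ 2 ≤ ∑ S, transferRate U μ T x S j := by
  have hD := notMem_suppressed hT hj
  have hm' : (0 : ℝ) < m := by exact_mod_cast hm
  have hx' : (0 : ℝ) < peers x := by exact_mod_cast Nat.pos_of_ne_zero hx
  have hterm : ∀ S : PeerType m,
      (if j ∈ S.1 then 0 else (x S : ℝ)) * ((U + μ * count x j) / (m * peers x)) ≤
        transferRate U μ T x S j := by
    intro S
    by_cases hS : j ∈ S.1
    · simp [hS, transferRate]
    · have hjn : j ∉ S.1 ∪ suppressed T x := by simp [hS, hD]
      rw [transferRate, if_neg hjn, if_neg hS]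
      have hcard : ∀ R : Finset (Fin m), j ∈ R →
          0 < ((R \ (S.1 ∪ suppressed T x)).card : ℝ) ∧
          ((R \ (S.1 ∪ suppressed T x)).card : ℝ) ≤ m := by
        intro R hR
        constructor
        · exact_mod_cast card_pos.2 ⟨j, mem_sdiff.2 ⟨hR, hjn⟩⟩
        · exact_mod_cast (card_le_univ (R \ (S.1 ∪ suppressed T x))).trans_eq (Fintype.card_fin m)
      calc (x S : ℝ) * ((U + μ * count x j) / (m * peers x))
          = (x S : ℝ) / peers x * (U / m + μ * count x j / m) := by
            field_simp
        _ ≤ _ := by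
          gcongr
          · exact (hcard univ (mem_univ j)).1
          · exact_mod_cast (hcard univ (mem_univ j)).2
          · rw [count, Nat.cast_sum, mul_sum, sum_div]
            refine sum_le_sum fun R _ => ?_
            split_ifs with hR
            · have := hcard R.1 hR
              gcongr
              · exact this.1
              · exact_mod_cast this.2
            · simp
  refine le_trans ?_ (sum_le_sum fun S _ => hterm S)
  rw [← sum_mul]
  have hsum : ∑ S : PeerType m, (if j ∈ S.1 then 0 else (x S : ℝ)) = peers x - count x j := by
    rw [peers, count, Nat.cast_sum, Nat.cast_sum, ← sum_sub_distrib]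
    refine sum_congr rfl fun S _ => ?_
    split_ifs <;> simp
  have hfrac : (peers x : ℝ) / m ≤ peers x - count x j := by
    have h1 : m * count x j ≤ (m - 1) * peers x := by
      refine le_trans ?_ (sum_count_le hm x)
      have := card_nsmul_le_sum univ (fun i => count x i) (count x j)
        fun i _ => hj.le.trans (minCount_le_count x i)
      simpa using this
    have h2 : (m : ℝ) * count x j ≤ (m - 1) * peers x := by
      have := (Nat.cast_le (α := ℝ)).2 h1
      push_cast [Nat.cast_sub (show 1 ≤ m from hm)] at this
      exact this
    rw [div_le_iff₀ hm']
    linarith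
  rw [hsum, ← hj]
  calc (U + μ * count x j) / m ^ 2
      = (peers x : ℝ) / m * ((U + μ * count x j) / (m * peers x)) := by
        field_simp
    _ ≤ _ := by gcongr

/-! ### The Lyapunov function -/

/-- Total amount by which the chunk counts fall short of the level `M`. -/
def shortfall (M : ℕ) (x : State m) : ℕ := ∑ i, (M - count x i)

/-- Total amount by which the chunk counts fall short of the largest count by more than `B`. -/
def excessGap (B : ℕ) (x : State m) : ℕ := ∑ i, (maxCount x - count x i - B)

/-- Lyapunov function. The number of missing chunks decreases at a large rate if the rarest chunk
is frequent; the shortfall decreases if the rarest chunk is rare and no other chunk is much more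
frequent; the excess gap decreases if it is rare and some other chunk is much more frequent. -/
def lyapunov (M B K₁ K₂ : ℕ) (x : State m) : ℕ :=
  missing x + K₂ * shortfall M x + K₁ * excessGap B x

lemma lyapunov_arrive (hm : 0 < m) (M B K₁ K₂ : ℕ) (x : State m) :
    lyapunov M B K₁ K₂ (arrive x) = lyapunov M B K₁ K₂ x + m := by
  simp only [lyapunov, shortfall, excessGap, maxCount, missing_arrive hm, count_arrive hm]
  ring

lemma shortfall_transfer (M : ℕ) {x : State m} {S : PeerType m} (hS : x S ≠ 0) {j : Fin m}
    (hj : j ∉ S.1) (hu : insert j S.1 ≠ univ) :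
    shortfall M (transfer x S j) + (if count x j < M then 1 else 0) ≤ shortfall M x := by
  rw [shortfall, shortfall, ← add_sum_erase _ _ (mem_univ j), ← add_sum_erase _ _ (mem_univ j)]
  have h2 : ∑ i ∈ univ.erase j, (M - count (transfer x S j) i) =
      ∑ i ∈ univ.erase j, (M - count x i) :=
    sum_congr rfl fun i hi => by
      rw [count_transfer hS hj hu, if_neg (ne_of_mem_erase hi), add_zero]
  rw [h2, count_transfer hS hj hu, if_pos rfl]
  split_ifs <;> omega

lemma shortfall_transfer_le (M : ℕ) {x : State m} {S : PeerType m} (hS : x S ≠ 0) {j : Fin m}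
    (hj : j ∉ S.1) (hu : insert j S.1 = univ) :
    shortfall M (transfer x S j) ≤ shortfall M x + m := by
  have : shortfall M (transfer x S j) ≤ ∑ i, (M - count x i + 1) :=
    sum_le_sum fun i _ => by
      have := count_transfer_of_eq_univ hS hj hu i
      split_ifs at this <;> omega
  simpa [sum_add_distrib, shortfall] using this

lemma shortfall_transfer_of_lt {M : ℕ} {x : State m} (hM : M < minCount x) {S : PeerType m}
    (hS : x S ≠ 0) {j : Fin m} (hj : j ∉ S.1) :
    shortfall M (transfer x S j) = 0 := by
  refine sum_eq_zero fun i _ => ?_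
  have h1 := minCount_le_count x i
  by_cases hu : insert j S.1 = univ
  · have := count_transfer_of_eq_univ hS hj hu i
    split_ifs at this <;> omega
  · have := count_transfer hS hj hu i
    omega

/-- If chunks are suppressed, then a transfer of `j` only shrinks the gap of `j`. Otherwise all gaps
are below `T`, and at most `B` after the transfer. -/
lemma excessGap_transfer (hm : 0 < m) {T : ℝ} {B : ℕ} (hB : T + 2 ≤ B) {x : State m}
    {S : PeerType m} {j : Fin m} (h : Enabled T x S j) :
    excessGap B (transfer x S j) + (if count x j + B < maxCount x then 1 else 0) ≤
      excessGap B x := by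
  obtain ⟨hS, hj, hD⟩ := h
  by_cases hgap : (minCount x : ℝ) + T ≤ maxCount x
  · have hlt : count x j < maxCount x := by
      refine lt_of_le_of_ne (count_le_maxCount x j) fun h => hD ?_
      exact mem_suppressed.2 ⟨h, hgap⟩
    rw [excessGap, excessGap, ← add_sum_erase _ _ (mem_univ j), ← add_sum_erase _ _ (mem_univ j)]
    by_cases hu : insert j S.1 = univ
    · have hmax : maxCount (transfer x S j) ≤ maxCount x - 1 := by
        refine maxCount_le hm fun i => ?_
        have h1 := count_transfer_of_eq_univ hS hj hu i
        have h2 := count_le_maxCount x i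
        split_ifs at h1 with hi
        · subst hi; omega
        · omega
      have h2 : ∑ i ∈ univ.erase j,
            (maxCount (transfer x S j) - count (transfer x S j) i - B) ≤
          ∑ i ∈ univ.erase j, (maxCount x - count x i - B) :=
        sum_le_sum fun i hi => by
          have h1 := count_transfer_of_eq_univ hS hj hu i
          rw [if_neg (ne_of_mem_erase hi)] at h1
          omega
      have h3 := count_transfer_of_eq_univ hS hj hu j
      rw [if_pos rfl] at h3
      split_ifs <;> omega
    · have hmax : maxCount (transfer x S j) ≤ maxCount x := by
        refine maxCount_le hm fun i => ?_
        have h1 := count_transfer hS hj hu i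
        have h2 := count_le_maxCount x i
        split_ifs at h1 with hi
        · subst hi; omega
        · omega
      have h2 : ∑ i ∈ univ.erase j,
            (maxCount (transfer x S j) - count (transfer x S j) i - B) ≤
          ∑ i ∈ univ.erase j, (maxCount x - count x i - B) :=
        sum_le_sum fun i hi => by
          have h1 := count_transfer hS hj hu i
          rw [if_neg (ne_of_mem_erase hi)] at h1
          omega
      have h3 := count_transfer hS hj hu j
      rw [if_pos rfl] at h3
      split_ifs <;> omega
  · have hgap' : maxCount x + 2 ≤ minCount x + B := by
      have : (maxCount x : ℝ) + 2 ≤ minCount x + B := by linarith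
      exact_mod_cast this
    have hcount : ∀ i, count (transfer x S j) i ≤ count x i + 1 ∧
        count x i ≤ count (transfer x S j) i + 1 := by
      intro i
      by_cases hu : insert j S.1 = univ
      · have h1 := count_transfer_of_eq_univ hS hj hu i
        split_ifs at h1 <;> omega
      · have h1 := count_transfer hS hj hu i
        split_ifs at h1 <;> omega
    have hmax : maxCount (transfer x S j) ≤ maxCount x + 1 :=
      maxCount_le hm fun i => (hcount i).1.trans (by have := count_le_maxCount x i; omega)
    have hzero : excessGap B (transfer x S j) = 0 := by
      refine sum_eq_zero fun i _ => ?_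
      have h1 := hcount i
      have h2 := minCount_le_count x i
      omega
    have h2 := minCount_le_count x j
    rw [hzero, if_neg (by omega)]
    exact Nat.zero_le _

/-! ### Increments of the Lyapunov function -/

lemma lyapunov_transfer_le_of_ne (hm : 0 < m) {T : ℝ} {M B K₁ K₂ : ℕ} (hB : T + 2 ≤ B)
    {x : State m} {S : PeerType m} {j : Fin m} (h : Enabled T x S j) (hu : insert j S.1 ≠ univ) :
    (lyapunov M B K₁ K₂ (transfer x S j) : ℝ) - lyapunov M B K₁ K₂ x ≤
      -1 - if count x j < M then (K₂ : ℝ) else 0 := by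
  have h1 := missing_transfer h.1 h.2.1
  have h2 := Nat.mul_le_mul_left K₂ (shortfall_transfer M h.1 h.2.1 hu)
  have h3 := Nat.mul_le_mul_left K₁ (excessGap_transfer hm hB h)
  have h4 : lyapunov M B K₁ K₂ (transfer x S j) + 1 + (if count x j < M then K₂ else 0) ≤
      lyapunov M B K₁ K₂ x := by
    simp only [lyapunov]
    split_ifs at * <;> lia
  have h5 : ((lyapunov M B K₁ K₂ (transfer x S j) + 1 +
      (if count x j < M then K₂ else 0) : ℕ) : ℝ) ≤ lyapunov M B K₁ K₂ x := by exact_mod_cast h4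
  push_cast at h5
  linarith

lemma lyapunov_transfer_le (hm : 0 < m) {T : ℝ} {M B K₁ K₂ : ℕ} (hB : T + 2 ≤ B)
    {x : State m} {S : PeerType m} {j : Fin m} (h : Enabled T x S j) :
    (lyapunov M B K₁ K₂ (transfer x S j) : ℝ) - lyapunov M B K₁ K₂ x ≤
      -1 + K₂ * m - if count x j + B < maxCount x then (K₁ : ℝ) else 0 := by
  have h1 := missing_transfer h.1 h.2.1
  have h2 : shortfall M (transfer x S j) ≤ shortfall M x + m := by
    by_cases hu : insert j S.1 = univ
    · exact shortfall_transfer_le M h.1 h.2.1 hu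
    · have := shortfall_transfer M h.1 h.2.1 hu
      omega
  replace h2 := Nat.mul_le_mul_left K₂ h2
  have h3 := Nat.mul_le_mul_left K₁ (excessGap_transfer hm hB h)
  have h4 : lyapunov M B K₁ K₂ (transfer x S j) + 1 +
      (if count x j + B < maxCount x then K₁ else 0) ≤ lyapunov M B K₁ K₂ x + K₂ * m := by
    simp only [lyapunov]
    split_ifs at * <;> lia
  have h5 : ((lyapunov M B K₁ K₂ (transfer x S j) + 1 +
      (if count x j + B < maxCount x then K₁ else 0) : ℕ) : ℝ) ≤
      (lyapunov M B K₁ K₂ x + K₂ * m : ℕ) := by exact_mod_cast h4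
  push_cast at h5
  linarith

lemma lyapunov_transfer_le_of_lt (hm : 0 < m) {T : ℝ} {M B K₁ K₂ : ℕ} (hB : T + 2 ≤ B)
    {x : State m} (hM : M < minCount x) {S : PeerType m} {j : Fin m} (h : Enabled T x S j) :
    (lyapunov M B K₁ K₂ (transfer x S j) : ℝ) - lyapunov M B K₁ K₂ x ≤ -1 := by
  have h1 := missing_transfer h.1 h.2.1
  have h2 := shortfall_transfer_of_lt hM h.1 h.2.1
  have h3 := Nat.mul_le_mul_left K₁ (excessGap_transfer hm hB h)
  have h4 : lyapunov M B K₁ K₂ (transfer x S j) + 1 ≤ lyapunov M B K₁ K₂ x := by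
    simp only [lyapunov, h2]
    lia
  have h5 : ((lyapunov M B K₁ K₂ (transfer x S j) + 1 : ℕ) : ℝ) ≤ lyapunov M B K₁ K₂ x := by
    exact_mod_cast h4
  push_cast at h5
  linarith

/-! ### Negative drift -/

/-- The generator of the chain, applied to `f`. -/
def drift (lam U μ T : ℝ) (f : State m → ℝ) (x : State m) : ℝ :=
  lam * (f (arrive x) - f x) +
    ∑ S : PeerType m, ∑ j : Fin m, transferRate U μ T x S j * (f (transfer x S j) - f x)

/-- Let `j₀` be a rarest chunk. Suppose that, up to an error `c` in each rate-weighted increment, a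
transfer of `j₀` lowers the Lyapunov function by `K`, and no other transfer raises it. Then the
drift is at most that of the arrivals and of the errors, minus `K` times the lower bound of
`le_sum_transferRate` for the rate at which `j₀` is transferred. -/
lemma drift_lyapunov_le (hm : 0 < m) {lam U μ T : ℝ} (hU : 0 ≤ U) (hμ : 0 ≤ μ) (hT : 0 < T)
    (M B K₁ K₂ : ℕ) {x : State m} (hx : peers x ≠ 0) {j₀ : Fin m} (hj₀ : count x j₀ = minCount x)
    {K c : ℝ} (hK : 0 ≤ K) (hc : 0 ≤ c)
    (h : ∀ S j, Enabled T x S j → transferRate U μ T x S j *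
      ((lyapunov M B K₁ K₂ (transfer x S j) : ℝ) - lyapunov M B K₁ K₂ x) ≤
        c - if j = j₀ then K * transferRate U μ T x S j else 0) :
    drift lam U μ T (fun z => (lyapunov M B K₁ K₂ z : ℝ)) x ≤
      lam * m + Fintype.card (PeerType m) * m * c - K * ((U + μ * minCount x) / m ^ 2) := by
  have h1 : ∑ S : PeerType m, ∑ j : Fin m, transferRate U μ T x S j *
      ((lyapunov M B K₁ K₂ (transfer x S j) : ℝ) - lyapunov M B K₁ K₂ x) ≤
      ∑ S : PeerType m, ∑ j : Fin m,
        (c - if j = j₀ then K * transferRate U μ T x S j else 0) := by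
    refine sum_le_sum fun S _ => sum_le_sum fun j _ => ?_
    by_cases he : Enabled T x S j
    · exact h S j he
    · simp [transferRate_eq_zero he, hc]
  have h2 : ∑ S : PeerType m, ∑ j : Fin m,
        (c - if j = j₀ then K * transferRate U μ T x S j else 0) =
      Fintype.card (PeerType m) * m * c - K * ∑ S, transferRate U μ T x S j₀ := by
    simp only [sum_sub_distrib, sum_ite_eq', mem_univ, if_true, sum_const, card_univ,
      Fintype.card_fin, nsmul_eq_mul, mul_sum]
    ring
  have h3 := mul_le_mul_of_nonneg_left (le_sum_transferRate hm hU hμ hT hx hj₀) hK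
  rw [drift]
  simp only [lyapunov_arrive hm]
  push_cast
  linarith

lemma exists_ne_fin (hm : 2 ≤ m) (j : Fin m) : ∃ i, i ≠ j :=
  have : Nontrivial (Fin m) := Fin.nontrivial_iff_two_le.2 hm
  exists_ne j

/-- If all counts are at most `A`, almost all peers of a large population have no chunk, so that
departures are rare. -/
lemma transferRate_le_of_maxCount_le (hm : 2 ≤ m) {U μ T : ℝ} (hU : 0 ≤ U) (hμ : 0 ≤ μ)
    {x : State m} {A : ℕ} (hA : maxCount x ≤ A) {S : PeerType m} {j : Fin m}
    (h : Enabled T x S j) (hu : insert j S.1 = univ) :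
    transferRate U μ T x S j ≤ A * (U + μ * A) / peers x := by
  obtain ⟨i, hi⟩ := exists_ne_fin hm j
  have h1 : x S ≤ A :=
    (le_count x (mem_of_insert_eq_univ hu hi)).trans ((count_le_maxCount x i).trans hA)
  have h2 : count x j ≤ A := (count_le_maxCount x j).trans hA
  calc transferRate U μ T x S j ≤ (x S : ℝ) / peers x * (U + μ * count x j) :=
        transferRate_le hU hμ h
    _ ≤ (A : ℝ) / peers x * (U + μ * A) := by gcongr
    _ = _ := by ring

/-- Departures by a chunk `j` other than `i` are departures of peers that have chunk `i`. -/
lemma transferRate_le_of_count_le {U μ T : ℝ} (hU : 0 ≤ U) (hμ : 0 ≤ μ)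
    {x : State m} (hx : peers x ≠ 0) {M : ℕ} {i j : Fin m} (hij : i ≠ j) (hM : count x i ≤ M)
    {S : PeerType m} (h : Enabled T x S j) (hu : insert j S.1 = univ) :
    transferRate U μ T x S j ≤ M * (U + μ) := by
  have h1 : x S ≤ M := (le_count x (mem_of_insert_eq_univ hu hij)).trans hM
  have hn : (1 : ℝ) ≤ peers x := by exact_mod_cast Nat.one_le_iff_ne_zero.2 hx
  have hn0 : (0 : ℝ) < peers x := by linarith
  calc transferRate U μ T x S j ≤ (x S : ℝ) / peers x * (U + μ * count x j) :=
        transferRate_le hU hμ h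
    _ ≤ (M : ℝ) / peers x * (U * peers x + μ * peers x) := by
        gcongr
        · exact le_mul_of_one_le_right hU hn
        · exact count_le_peers x j
    _ = _ := by field_simp

/-- The Lyapunov function has drift at most `-1` outside a finite set. With `A = M + B`:
if all counts are at most `A`, departures are rare, and either the number of missing chunks or the
shortfall decreases; if some count exceeds `A`, then either all counts exceed `M` and the shortfall
stays `0`, or the rarest chunk has a gap larger than `B`, which shrinks whenever it is
transferred. -/
theorem exists_lyapunov_drift_le (hm : 2 ≤ m) {lam U μ T : ℝ} (hU : 0 < U)
    (hμ : 0 < μ) (hT : 0 < T) :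
    ∃ (V : State m → ℕ) (N : ℕ), ∀ x, N < peers x →
      drift lam U μ T (fun z => (V z : ℝ)) x ≤ -1 := by
  have hm0 : 0 < m := by omega
  have hm' : (0 : ℝ) < (m : ℝ) ^ 2 := by positivity
  set P : ℝ := Fintype.card (PeerType m) * m with hP
  have hP0 : 0 ≤ P := by positivity
  obtain ⟨B, hB⟩ := exists_nat_ge (T + 2)
  -- Where the rarest count is at least `M`, transfers outweigh arrivals.
  obtain ⟨M, hM⟩ := exists_nat_ge (m ^ 2 * (lam * m + 2) / μ)
  -- Where the rarest count is below `M`, the seed alone fills the shortfall fast enough.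
  obtain ⟨K₂, hK₂⟩ := exists_nat_ge (m ^ 2 * (lam * m + 2) / U)
  -- The excess gap outweighs the increase of the shortfall by departures.
  obtain ⟨K₃, hK₃⟩ := exists_nat_ge
    (m ^ 2 * (lam * m + 1 + P * (K₂ * m * (M * (U + μ)))) / U)
  obtain ⟨N, hN⟩ := exists_nat_ge
    (P * (K₂ * (m + 1) * ((M + B : ℕ) * (U + μ * (M + B : ℕ)))))
  rw [div_le_iff₀ hμ] at hM
  rw [div_le_iff₀ hU] at hK₂ hK₃
  have hM2 : lam * m + 2 ≤ μ * M / m ^ 2 := by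
    rw [le_div_iff₀ hm']; linarith
  have hU2 : 0 ≤ U / (m : ℝ) ^ 2 := by positivity
  have hμ2 : ∀ k : ℕ, 0 ≤ μ * (k : ℝ) / (m : ℝ) ^ 2 := fun k => by positivity
  refine ⟨lyapunov M B (K₂ * m + K₃) K₂, N, fun x hx => ?_⟩
  have hx0 : peers x ≠ 0 := by omega
  have hn : (0 : ℝ) < peers x := by exact_mod_cast Nat.pos_of_ne_zero hx0
  obtain ⟨j₀, hj₀⟩ := exists_count_eq_minCount hm0 x
  have htr := transferRate_nonneg hU.le hμ.le T x
  by_cases hA : maxCount x ≤ M + B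
  · -- `c` bounds the increase of the shortfall by departures, which are rare here.
    set c : ℝ := K₂ * (m + 1) * ((M + B : ℕ) * (U + μ * (M + B : ℕ)) / peers x) with hc
    have hc0 : 0 ≤ c := by positivity
    have hPc : P * c ≤ 1 := by
      have hNx : (N : ℝ) ≤ peers x := by exact_mod_cast hx.le
      have : P * c = P * (K₂ * (m + 1) * ((M + B : ℕ) * (U + μ * (M + B : ℕ)))) / peers x := by
        rw [hc]; ring
      rw [this, div_le_one hn]
      exact hN.trans hNx
    have hcomp : ∀ S j, Enabled T x S j → insert j S.1 = univ →
        transferRate U μ T x S j * (K₂ * (m + 1)) ≤ c := by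
      intro S j h hu
      rw [hc, mul_comm]
      gcongr
      exact transferRate_le_of_maxCount_le hm hU.le hμ.le hA h hu
    by_cases hmin : M ≤ minCount x
    · have key := drift_lyapunov_le hm0 (lam := lam) hU.le hμ.le hT M B (K₂ * m + K₃) K₂ hx0 hj₀
        (K := 1) (c := c) zero_le_one hc0 (fun S j h => by
          have ht := htr S j
          by_cases hu : insert j S.1 = univ
          · have h1 := mul_le_mul_of_nonneg_left
              (lyapunov_transfer_le (M := M) (K₁ := K₂ * m + K₃) (K₂ := K₂) hm0 hB h) ht
            have h2 := hcomp S j h hu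
            have h3 : 0 ≤ transferRate U μ T x S j * K₂ := by positivity
            have h4 : 0 ≤ transferRate U μ T x S j * ((K₂ * m + K₃ : ℕ) : ℝ) := by positivity
            split_ifs at h1 ⊢ <;> linarith
          · have h1 := mul_le_mul_of_nonneg_left
              (lyapunov_transfer_le_of_ne (M := M) (K₁ := K₂ * m + K₃) (K₂ := K₂) hm0 hB h hu) ht
            have h3 : 0 ≤ transferRate U μ T x S j * K₂ := by positivity
            split_ifs at h1 ⊢ <;> linarith)
      have h5 : μ * (M : ℝ) / m ^ 2 ≤ μ * minCount x / m ^ 2 := by gcongr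
      rw [add_div] at key
      linarith
    · push Not at hmin
      have key := drift_lyapunov_le hm0 (lam := lam) hU.le hμ.le hT M B (K₂ * m + K₃) K₂ hx0 hj₀
        (K := K₂) (c := c) (Nat.cast_nonneg _) hc0 (fun S j h => by
          have ht := htr S j
          by_cases hu : insert j S.1 = univ
          · have h1 := mul_le_mul_of_nonneg_left
              (lyapunov_transfer_le (M := M) (K₁ := K₂ * m + K₃) (K₂ := K₂) hm0 hB h) ht
            have h2 := hcomp S j h hu
            have h3 : 0 ≤ transferRate U μ T x S j * K₂ := by positivity
            have h4 : 0 ≤ transferRate U μ T x S j * ((K₂ * m + K₃ : ℕ) : ℝ) := by positivity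
            split_ifs at h1 ⊢ <;> linarith
          · have h1 := mul_le_mul_of_nonneg_left
              (lyapunov_transfer_le_of_ne (M := M) (K₁ := K₂ * m + K₃) (K₂ := K₂) hm0 hB h hu) ht
            have h3 : 0 ≤ transferRate U μ T x S j * K₂ := by positivity
            by_cases hj : j = j₀
            · subst hj
              rw [if_pos (hj₀.trans_lt hmin)] at h1
              rw [if_pos rfl]
              linarith
            · rw [if_neg hj]
              split_ifs at h1 <;> linarith)
      have h5 : lam * m + 2 ≤ K₂ * (U / m ^ 2) := by
        rw [← mul_div_assoc, le_div_iff₀ hm']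
        linarith
      have h6 : 0 ≤ K₂ * (μ * (minCount x : ℝ) / m ^ 2) := mul_nonneg (Nat.cast_nonneg _) (hμ2 _)
      rw [add_div, mul_add] at key
      linarith
  · push Not at hA
    by_cases hmin : M < minCount x
    · have key := drift_lyapunov_le hm0 (lam := lam) hU.le hμ.le hT M B (K₂ * m + K₃) K₂ hx0 hj₀
        (K := 1) (c := 0) zero_le_one le_rfl (fun S j h => by
          have ht := htr S j
          have h1 := mul_le_mul_of_nonneg_left
            (lyapunov_transfer_le_of_lt (K₁ := K₂ * m + K₃) (K₂ := K₂) hm0 hB hmin h) ht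
          split_ifs <;> linarith)
      have h5 : μ * (M : ℝ) / m ^ 2 ≤ μ * minCount x / m ^ 2 := by gcongr
      rw [add_div] at key
      linarith
    · push Not at hmin
      have key := drift_lyapunov_le hm0 (lam := lam) hU.le hμ.le hT M B (K₂ * m + K₃) K₂ hx0 hj₀
        (K := K₃) (c := K₂ * m * (M * (U + μ))) (Nat.cast_nonneg _) (by positivity)
        (fun S j h => by
          have ht := htr S j
          have hc0 : 0 ≤ (K₂ : ℝ) * m * (M * (U + μ)) := by positivity
          have h1 := mul_le_mul_of_nonneg_left
            (lyapunov_transfer_le (M := M) (K₁ := K₂ * m + K₃) (K₂ := K₂) hm0 hB h) ht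
          by_cases hj : j = j₀
          · subst hj
            rw [if_pos (by omega)] at h1
            rw [if_pos rfl]
            push_cast at h1
            linarith
          · rw [if_neg hj]
            have h4 : 0 ≤ transferRate U μ T x S j * ((K₂ * m + K₃ : ℕ) : ℝ) := by positivity
            by_cases hu : insert j S.1 = univ
            · have h2 : transferRate U μ T x S j * (K₂ * m) ≤ K₂ * m * (M * (U + μ)) := by
                rw [mul_comm]
                gcongr
                exact transferRate_le_of_count_le hU.le hμ.le hx0 (Ne.symm hj)
                  (hj₀.trans_le hmin) h hu
              split_ifs at h1 <;> linarith
            · have h1 := mul_le_mul_of_nonneg_left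
                (lyapunov_transfer_le_of_ne (M := M) (K₁ := K₂ * m + K₃) (K₂ := K₂) hm0 hB h hu) ht
              have h3 : 0 ≤ transferRate U μ T x S j * K₂ := by positivity
              split_ifs at h1 <;> linarith)
      have h5 : lam * m + 1 + P * (K₂ * m * (M * (U + μ))) ≤ K₃ * (U / m ^ 2) := by
        rw [← mul_div_assoc, le_div_iff₀ hm']
        linarith
      have h6 : 0 ≤ K₃ * (μ * (minCount x : ℝ) / m ^ 2) := mul_nonneg (Nat.cast_nonneg _) (hμ2 _)
      rw [add_div, mul_add] at key
      linarith

/-! ### The transition rates -/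

lemma arrive_ne (hm : 0 < m) (x : State m) : arrive x ≠ x := fun h => by
  have := peers_arrive hm x
  rw [h] at this
  omega

lemma transfer_ne {T : ℝ} {x : State m} {S : PeerType m} {j : Fin m} (h : Enabled T x S j) :
    transfer x S j ≠ x := fun he => by
  have := missing_transfer h.1 h.2.1
  rw [he] at this
  omega

lemma offDiag_rate (hm : 0 < m) (lam U μ T : ℝ) (x x' : State m) :
    CTMC.offDiag (rate lam U μ T) x x' = rate lam U μ T x x' := by
  rw [CTMC.offDiag]
  split_ifs with h
  · subst h
    rw [rate, if_neg (arrive_ne hm x').symm, zero_add]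
    refine (sum_eq_zero fun S _ => sum_eq_zero fun j _ => ?_).symm
    by_cases he : Enabled T x' S j
    · rw [if_neg (transfer_ne he).symm]
    · simp [transferRate_eq_zero he]
  · rfl

lemma tsum_offDiag_rate_mul (hm : 0 < m) (lam U μ T : ℝ) (x : State m) (f : State m → ℝ≥0∞) :
    ∑' x', CTMC.offDiag (rate lam U μ T) x x' * f x' =
      ENNReal.ofReal lam * f (arrive x) +
        ∑ S, ∑ j, ENNReal.ofReal (transferRate U μ T x S j) * f (transfer x S j) := by
  classical
  have hite : ∀ (y : State m) (c : ℝ≥0∞),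
      ∑' x', (if x' = y then c else 0) * f x' = c * f y := by
    intro y c
    rw [tsum_eq_single y fun z hz => by rw [if_neg hz, zero_mul], if_pos rfl]
  simp only [offDiag_rate hm, rate, add_mul, sum_mul]
  rw [ENNReal.tsum_add, hite, Summable.tsum_finsetSum fun _ _ => ENNReal.summable]
  congr 1
  refine sum_congr rfl fun S _ => ?_
  rw [Summable.tsum_finsetSum fun _ _ => ENNReal.summable]
  exact sum_congr rfl fun j _ => hite _ _

lemma exitRate_rate (hm : 0 < m) (lam U μ T : ℝ) (x : State m) :
    CTMC.exitRate (rate lam U μ T) x =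
      ENNReal.ofReal lam + ∑ S, ∑ j, ENNReal.ofReal (transferRate U μ T x S j) := by
  have := tsum_offDiag_rate_mul hm lam U μ T x fun _ => 1
  simpa [CTMC.exitRate] using this

/-- A negative drift, in the form in which the general criterion uses it. -/
lemma tsum_offDiag_rate_mul_add_one_le (hm : 0 < m) {lam U μ T : ℝ} (hlam : 0 ≤ lam) (hU : 0 ≤ U)
    (hμ : 0 ≤ μ) {V : State m → ℕ} {x : State m}
    (h : drift lam U μ T (fun z => (V z : ℝ)) x ≤ -1) :
    ∑' x', CTMC.offDiag (rate lam U μ T) x x' * ((V x' : ℝ≥0) : ℝ≥0∞) + 1 ≤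
      CTMC.exitRate (rate lam U μ T) x * ((V x : ℝ≥0) : ℝ≥0∞) := by
  have hcast : ∀ k : ℕ, ((k : ℝ≥0) : ℝ≥0∞) = ENNReal.ofReal k := fun k => by simp
  have htr := transferRate_nonneg hU hμ T x
  have hsum : ∀ g : PeerType m → Fin m → ℝ, (∀ S j, 0 ≤ g S j) →
      ∑ S, ∑ j, ENNReal.ofReal (g S j) = ENNReal.ofReal (∑ S, ∑ j, g S j) := by
    intro g hg
    rw [ENNReal.ofReal_sum_of_nonneg fun S _ => sum_nonneg fun j _ => hg S j]
    exact sum_congr rfl fun S _ => (ENNReal.ofReal_sum_of_nonneg fun j _ => hg S j).symm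
  have h0 : 0 ≤ ∑ S, ∑ j, transferRate U μ T x S j :=
    sum_nonneg fun S _ => sum_nonneg fun j _ => htr S j
  have h1 : 0 ≤ ∑ S, ∑ j, transferRate U μ T x S j * (V (transfer x S j) : ℝ) :=
    sum_nonneg fun S _ => sum_nonneg fun j _ => mul_nonneg (htr S j) (Nat.cast_nonneg _)
  rw [tsum_offDiag_rate_mul hm lam U μ T x, exitRate_rate hm]
  simp only [hcast, ← ENNReal.ofReal_mul hlam, ← ENNReal.ofReal_mul (htr _ _)]
  rw [hsum _ htr, hsum _ fun S j => mul_nonneg (htr S j) (Nat.cast_nonneg _),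
    ← ENNReal.ofReal_add hlam h0, ← ENNReal.ofReal_mul (by positivity), ← ENNReal.ofReal_one,
    ← ENNReal.ofReal_add (by positivity) h1, ← ENNReal.ofReal_add (by positivity) zero_le_one]
  refine ENNReal.ofReal_le_ofReal ?_
  simp only [drift, mul_sub, sum_sub_distrib] at h
  simp only [← sum_mul] at h
  linarith

/-! ### Positive recurrence -/

lemma eq_zero_of_peers_eq_zero {x : State m} (h : peers x = 0) : x = 0 := by
  ext S
  exact (sum_eq_zero_iff.1 h) S (mem_univ S)

/-- A rarest chunk can always be transferred, and each transfer lowers the number of missing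
chunks, until no peer is left. -/
lemma reachable_zero (hm : 0 < m) (lam : ℝ) {U μ T : ℝ} (hU : 0 < U) (hμ : 0 < μ) (hT : 0 < T)
    (x : State m) : CTMC.Reachable (rate lam U μ T) x 0 := by
  induction hn : missing x using Nat.strong_induction_on generalizing x with
  | _ n ih =>
    by_cases hx : peers x = 0
    · rw [eq_zero_of_peers_eq_zero hx]
      exact Relation.ReflTransGen.refl
    obtain ⟨j, hj⟩ := exists_count_eq_minCount hm x
    have hpos : 0 < ∑ S, transferRate U μ T x S j :=
      lt_of_lt_of_le (by positivity) (le_sum_transferRate hm hU.le hμ.le hT hx hj)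
    obtain ⟨S, _, hS⟩ := exists_lt_of_sum_lt (s := univ) (f := fun _ : PeerType m => (0 : ℝ))
      (g := fun S => transferRate U μ T x S j) (by simpa using hpos)
    have he : Enabled T x S j := by
      by_contra he
      rw [transferRate_eq_zero he] at hS
      exact lt_irrefl _ hS
    refine Relation.ReflTransGen.head (b := transfer x S j) ?_ (ih _ ?_ _ rfl)
    · have hle : ENNReal.ofReal (transferRate U μ T x S j) ≤
          rate lam U μ T x (transfer x S j) := by
        rw [rate]
        refine le_add_left (le_trans ?_ (single_le_sum (f := fun S' => ∑ j',
          if transfer x S j = transfer x S' j' then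
            ENNReal.ofReal (transferRate U μ T x S' j') else 0)
          (fun _ _ => zero_le) (mem_univ S)))
        refine le_trans ?_ (single_le_sum (f := fun j' =>
          if transfer x S j = transfer x S j' then
            ENNReal.ofReal (transferRate U μ T x S j') else 0)
          (fun _ _ => zero_le) (mem_univ j))
        simp
      rw [CTMC.Step, offDiag_rate hm]
      exact (lt_of_lt_of_le (ENNReal.ofReal_pos.2 hS) hle).ne'
    · have := missing_transfer he.1 he.2.1
      omega

lemma finite_setOf_peers_le (N : ℕ) : {x : State m | peers x ≤ N}.Finite := by
  refine (Set.finite_Icc (0 : State m) fun _ => N).subset fun x hx => ⟨zero_le, fun S => ?_⟩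
  exact (single_le_sum (f := x) (fun _ _ => Nat.zero_le _) (mem_univ S)).trans hx

theorem isPositiveRecurrent (hm : 2 ≤ m) {lam U μ T : ℝ} (hlam : 0 < lam) (hU : 0 < U)
    (hμ : 0 < μ) (hT : 0 < T) : CTMC.IsPositiveRecurrent (rate (m := m) lam U μ T) 0 := by
  have hm0 : 0 < m := by omega
  have hc : ∀ x, ENNReal.ofReal lam ≤ CTMC.exitRate (rate (m := m) lam U μ T) x := fun x => by
    rw [exitRate_rate hm0]
    exact le_self_add
  have hlam0 : ENNReal.ofReal lam ≠ 0 := by simpa using hlam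
  have h0 : ∀ x, CTMC.exitRate (rate (m := m) lam U μ T) x ≠ 0 := fun x h =>
    hlam0 (le_zero_iff.1 ((hc x).trans h.le))
  have h1 : ∀ x, CTMC.exitRate (rate (m := m) lam U μ T) x ≠ ∞ := fun x => by
    rw [exitRate_rate hm0]
    exact ENNReal.add_ne_top.2 ⟨ENNReal.ofReal_ne_top,
      ENNReal.sum_ne_top.2 fun S _ => ENNReal.sum_ne_top.2 fun j _ => ENNReal.ofReal_ne_top⟩
  have hacc := fun x => reachable_zero (m := m) hm0 lam hU hμ hT x
  have hne : ∀ x, ∀ᵐ ω ∂(CTMC.pathLaw (rate (m := m) lam U μ T) x),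
      ⨆ n, CTMC.jumpTime n ω = ∞ := by
    refine CTMC.nonexplosive_of_drift h0 h1 hlam (fun x => (peers x : ℝ≥0) + 1) (fun c => ?_)
      fun x => ?_
    · refine (finite_setOf_peers_le ⌊c⌋₊).subset fun x hx => ?_
      exact Nat.le_floor (le_self_add.trans hx)
    · rw [tsum_offDiag_rate_mul hm0, exitRate_rate hm0, peers_arrive hm0]
      have hle : ∑ S, ∑ j, ENNReal.ofReal (transferRate U μ T x S j) *
            (((peers (transfer x S j) : ℝ≥0) + 1 : ℝ≥0) : ℝ≥0∞) ≤
          (∑ S, ∑ j, ENNReal.ofReal (transferRate U μ T x S j)) *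
            (((peers x : ℝ≥0) + 1 : ℝ≥0) : ℝ≥0∞) := by
        simp only [sum_mul]
        refine sum_le_sum fun S _ => sum_le_sum fun j _ => ?_
        by_cases he : Enabled T x S j
        · gcongr
          exact peers_transfer_le he.1 j
        · simp [transferRate_eq_zero he]
      calc _ ≤ _ := add_le_add le_rfl hle
        _ ≤ _ := by
          rw [add_right_comm, add_mul _ _ (((peers x : ℝ≥0) + 1 : ℝ≥0) : ℝ≥0∞)]
          refine add_le_add ?_ le_rfl
          rw [← two_mul, mul_comm 2, mul_assoc]
          gcongr
          have : (((peers x + 1 : ℕ) : ℝ≥0) + 1) ≤ 2 * ((peers x : ℝ≥0) + 1) := by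
            push_cast
            rw [two_mul]
            gcongr
            exact le_add_self
          exact_mod_cast this
  refine ⟨hne, hacc, fun x y hy => ?_⟩
  obtain ⟨V, N, hV⟩ := exists_lyapunov_drift_le (lam := lam) hm hU hμ hT
  refine CTMC.lintegral_passageTime_lt_top h0 h1 hlam0 hc hne (fun z => (V z : ℝ≥0))
    (finite_setOf_peers_le N).toFinset (fun z => ?_) (fun z hz => ?_) y
    (fun z => (hacc z).trans hy) x
  · rw [tsum_offDiag_rate_mul hm0]
    exact ENNReal.add_ne_top.2 ⟨ENNReal.mul_ne_top ENNReal.ofReal_ne_top ENNReal.coe_ne_top,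
      ENNReal.sum_ne_top.2 fun S _ => ENNReal.sum_ne_top.2 fun j _ =>
        ENNReal.mul_ne_top ENNReal.ofReal_ne_top ENNReal.coe_ne_top⟩
  · refine tsum_offDiag_rate_mul_add_one_le hm0 hlam.le hU.le hμ.le (hV z ?_)
    simpa using hz

end ModeSuppression

end

theorem mainTheorem1 (m : ℕ) (hm : 2 ≤ m) (U μ T : ℝ) (hU : 0 < U) (hμ : 0 < μ) (hT : 0 < T) :
    ModeSuppression.stabilityRegion m U μ T = Set.Ioi 0 := by
  ext lam
  exact ⟨fun h => h.1, fun h => ⟨h, ModeSuppression.isPositiveRecurrent hm h hU hμ hT⟩⟩
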